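/- Let $A_0$ be a Dedekind domain with fraction field $K_0$, let $Z$ be the set of closed points of $Y=\operatorname{Spec}A_0$ (the nonzero primes), and let $\operatorname{ord}_z$ be the valuation of $K_0$ at $z\in Z$. Let $N$ be a lattice (free abelian group of finite rank), $M=\operatorname{Hom}(N,\mathbb Z)$, $N_{\mathbb Q}=\mathbb Q\otimes N$, $M_{\mathbb Q}$ the dual of $N_{\mathbb Q}$, and $K_0[M]=\bigoplus_{m\in M}K_0\chi^m$ the group algebra. A pointed polyhedral cone is a finitely generated cone that contains no line; $\sigma^\vee\subset M_{\mathbb Q}$ denotes the dual of a cone $\sigma\subset N_{\mathbb Q}$. For a pointed polyhedral cone $\sigma\subset N_{\mathbb Q}$, a $\sigma$-polyhedron is a set $\Delta=Q+\sigma\subset N_{\mathbb Q}$ with $Q$ a nonempty polytope. A $\sigma$-polyhedral divisor over $A_0$ is a formal sum $\mathfrak D=\sum_{z\in Z}\Delta_z\cdot z$ of $\sigma$-polyhedra $\Delta_z$ with $\Delta_z=\sigma$ for all but finitely many $z$. For $m\in\sigma^\vee$ put $\mathfrak D(m)=\sum_z h_{\Delta_z}(m)\cdot z$ with $h_{\Delta_z}(m)=\min_{v\in\Delta_z}\langle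 m,v\rangle\in\mathbb Q$, and let $$A_0[\mathfrak D]=\bigoplus_{m\in\sigma^\vee\cap M}H^0\bigl(Y,\mathcal O_Y(\lfloor\mathfrak D(m)\rfloor)\bigr)\chi^m\subset K_0[M],$$ where $H^0(Y,\mathcal O_Y(D))=\{0\}\cup\{f\in K_0^*: \operatorname{ord}_z f+D_z\ge 0 \text{ for all } z\in Z\}$ for an integral divisor $D=\sum_z D_z\cdot z$. (i) Let $\sigma\subset N_{\mathbb Q}$ be a pointed polyhedral cone. For every $\sigma$-polyhedral divisor $\mathfrak D$ over $A_0$, the algebra $A_0[\mathfrak D]$ is normal and noetherian, and has the same fraction field as $K_0[M]$. (ii) Let $\sigma\subset N_{\mathbb Q}$ be a pointed polyhedral cone, and let $A=\bigoplus_{m}A_m\chi^m\subset K_0[M]$, with $A_m\subset K_0$, be a normal noetherian $M$-graded $A_0$-subalgebra whose graded piece of degree $0\in M$ is $A_0$, whose weight cone (the cone generated by the $m$ with $A_m\neq 0$) is $\sigma^\vee$, and which has the same fraction field as $K_0[M]$. Then there is a unique $\sigma$-polyhedral divisor $\mathfrak D$ over $A_0$ with $A=A_0[\mathfrak D]$.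 (iii) Let $f_1,\dots,f_r\in K_0^*$ and let $m_1,\dots,m_r\in M$ be nonzero vectors that generate the lattice $M$. Let $\sigma\subset N_{\mathbb Q}$ be the dual of the cone generated by $m_1,\dots,m_r$. Then $\sigma$ is a pointed polyhedral cone, $\sigma^\vee$ is generated by $m_1,\dots,m_r$, and the algebra $A=A_0[f_1\chi^{m_1},\dots,f_r\chi^{m_r}]$ has the same fraction field as $K_0[M]$. For $z\in Z$ put $$\Delta_z[f]=\{v\in N_{\mathbb Q}:\langle m_i,v\rangle\ge-\operatorname{ord}_z f_i,\ i=1,\dots,r\},$$ and suppose that $\Delta_z[f]\ne\emptyset$ for every $z\in Z$. Then $\mathfrak D[f]=\sum_z\Delta_z[f]\cdot z$ is a $\sigma$-polyhedral divisor, and the normalization of $A$ (its integral closure in its fraction field) is $A_0[\mathfrak D[f]]$. -/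

import Mathlib

open scoped Pointwise TensorProduct

/-- The rational vector space `N_ℚ = ℚ ⊗ N` of a lattice `N`. -/
abbrev RatSpace (N : Type*) [AddCommGroup N] : Type _ := ℚ ⊗[ℤ] N

/-- The lattice `M = Hom(N, ℤ)` dual to `N`. -/
abbrev DualLattice (N : Type*) [AddCommGroup N] : Type _ := Module.Dual ℤ N

/-- The dual `M_ℚ` of the rational vector space `N_ℚ`. -/
abbrev DualRatSpace (N : Type*) [AddCommGroup N] : Type _ := Module.Dual ℚ (RatSpace N)

/-- The inclusion `M → M_ℚ`; it sends `m` to the linear form `⟨m, ·⟩` on `N_ℚ`. -/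
noncomputable def toDualRat {N : Type*} [AddCommGroup N] :
    DualLattice N →ₗ[ℤ] DualRatSpace N :=
  Module.Dual.baseChange ℚ

theorem toDualRat_tmul {N : Type*} [AddCommGroup N] (m : DualLattice N) (q : ℚ) (n : N) :
    toDualRat m (q ⊗ₜ[ℤ] n) = q * (m n : ℚ) := by
  simp [toDualRat, mul_comm]

/-- The dual cone `σ^∨ ⊆ M_ℚ` of a cone `σ ⊆ N_ℚ`. -/
noncomputable def dualCone {N : Type*} [AddCommGroup N] (σ : PointedCone ℚ (RatSpace N)) :
    PointedCone ℚ (DualRatSpace N) :=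
  PointedCone.dual (Module.Dual.eval ℚ (RatSpace N)) (σ : Set (RatSpace N))

theorem mem_dualCone {N : Type*} [AddCommGroup N] {σ : PointedCone ℚ (RatSpace N)}
    {u : DualRatSpace N} : u ∈ dualCone σ ↔ ∀ v ∈ σ, 0 ≤ u v := Iff.rfl

/-- A polyhedral cone (generated by finitely many vectors) which contains no line. -/
def IsPointedPolyhedralCone {N : Type*} [AddCommGroup N] (σ : PointedCone ℚ (RatSpace N)) :
    Prop :=
  σ.FG ∧ (σ : ConvexCone ℚ (RatSpace N)).Salient

/-- `Δ` is a `σ`-polyhedron: the Minkowski sum of a (nonempty) polytope and of the cone `σ`. -/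
def IsSigmaPolyhedron {N : Type*} [AddCommGroup N] (σ : PointedCone ℚ (RatSpace N))
    (Δ : Set (RatSpace N)) : Prop :=
  ∃ Q : Set (RatSpace N), Q.Finite ∧ Q.Nonempty ∧
    Δ = convexHull ℚ Q + (σ : Set (RatSpace N))

/-- A linear form in `σ^∨` attains its minimum on a `σ`-polyhedron. -/
theorem IsSigmaPolyhedron.exists_isLeast {N : Type*} [AddCommGroup N]
    {σ : PointedCone ℚ (RatSpace N)} {Δ : Set (RatSpace N)} (h : IsSigmaPolyhedron σ Δ)
    {u : DualRatSpace N} (hu : u ∈ dualCone σ) : ∃ c : ℚ, IsLeast (u '' Δ) c := by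
  obtain ⟨Q, hQ, hne, rfl⟩ := h
  obtain ⟨q, hq, hmin⟩ := Set.exists_min_image Q u hQ hne
  refine ⟨u q, ⟨q, ⟨q, subset_convexHull ℚ Q hq, 0, σ.zero_mem, add_zero q⟩, rfl⟩, ?_⟩
  rintro _ ⟨_, ⟨x, hx, s, hs, rfl⟩, rfl⟩
  have hx' : x ∈ {y : RatSpace N | u q ≤ u y} :=
    convexHull_min (fun y hy => hmin y hy) (convex_halfSpace_ge u.isLinear (u q)) hx
  have hs' : 0 ≤ u s := mem_dualCone.1 hu s hs
  have hx'' : u q ≤ u x := hx'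
  simp only [map_add]
  linarith

section Dedekind

variable {A₀ : Type*} [CommRing A₀] [IsDedekindDomain A₀]
  {K : Type*} [Field K] [Algebra A₀ K] [IsFractionRing A₀ K]

/-- The order of vanishing `ord_z f` of `f ∈ K₀` at the closed point `z` of `Spec A₀`
(meaningful for `f ≠ 0` only). The valuation in Mathlib is multiplicative: it sends `f ≠ 0`
to `exp (-ord_z f)`. -/
noncomputable def ordAt (z : IsDedekindDomain.HeightOneSpectrum A₀) (f : K) : ℤ :=
  -WithZero.log (z.valuation K f)

theorem neg_le_ordAt_iff (z : IsDedekindDomain.HeightOneSpectrum A₀) {f : K} (hf : f ≠ 0)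
    (n : ℤ) : -n ≤ ordAt z f ↔ z.valuation K f ≤ WithZero.exp n := by
  rw [ordAt, neg_le_neg_iff, WithZero.log_le_iff_le_exp]
  simpa using hf

variable (K) in
/-- The global sections `H⁰(Y, O_Y(D))` of an integral Weil divisor `D` on `Y = Spec A₀`:
zero, and the `f ∈ K₀^*` with `div f + D ≥ 0`. -/
noncomputable def globalSections (D : IsDedekindDomain.HeightOneSpectrum A₀ →₀ ℤ) :
    Submodule A₀ K where
  carrier := {f | f ≠ 0 → ∀ z, 0 ≤ ordAt z f + D z}
  zero_mem' := fun h => absurd rfl h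
  add_mem' := by
    intro f g hf hg hfg z
    have key : ∀ x : K, (x ≠ 0 → ∀ z, 0 ≤ ordAt z x + D z) →
        z.valuation K x ≤ WithZero.exp (D z) := by
      intro x hx
      by_cases h0 : x = 0
      · simp [h0]
      · exact (neg_le_ordAt_iff z h0 _).1 (by linarith [hx h0 z])
    have := (neg_le_ordAt_iff z hfg (D z)).2
      ((Valuation.map_add _ f g).trans (max_le (key f hf) (key g hg)))
    linarith
  smul_mem' := by
    intro a f hf haf z
    have hf0 : f ≠ 0 := by
      rintro rfl
      exact haf (smul_zero a)
    have h1 : z.valuation K f ≤ WithZero.exp (D z) :=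
      (neg_le_ordAt_iff z hf0 _).1 (by linarith [hf hf0 z])
    have h2 : z.valuation K (a • f) ≤ WithZero.exp (D z) := by
      rw [Algebra.smul_def, map_mul]
      exact (mul_le_of_le_one_left' (z.valuation_le_one a)).trans h1
    have := (neg_le_ordAt_iff z haf (D z)).2 h2
    linarith

theorem mem_globalSections {D : IsDedekindDomain.HeightOneSpectrum A₀ →₀ ℤ} {f : K} :
    f ∈ globalSections K D ↔ (f ≠ 0 → ∀ z, 0 ≤ ordAt z f + D z) := Iff.rfl

theorem ordAt_one (z : IsDedekindDomain.HeightOneSpectrum A₀) : ordAt z (1 : K) = 0 := by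
  simp [ordAt]

theorem ordAt_mul (z : IsDedekindDomain.HeightOneSpectrum A₀) {f g : K} (hf : f ≠ 0)
    (hg : g ≠ 0) : ordAt z (f * g) = ordAt z f + ordAt z g := by
  rw [ordAt, map_mul, WithZero.log_mul (by simpa using hf) (by simpa using hg), ordAt, ordAt]
  ring

theorem mul_mem_globalSections {D D' D'' : IsDedekindDomain.HeightOneSpectrum A₀ →₀ ℤ}
    (h : ∀ z, D z + D' z ≤ D'' z) {f g : K} (hf : f ∈ globalSections K D)
    (hg : g ∈ globalSections K D') : f * g ∈ globalSections K D'' := by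
  intro h0 z
  have hf0 := left_ne_zero_of_mul h0
  have hg0 := right_ne_zero_of_mul h0
  rw [ordAt_mul z hf0 hg0]
  linarith [hf hf0 z, hg hg0 z, h z]

end Dedekind

/-- A `σ`-polyhedral divisor `∑ Δ_z · z` over the Dedekind domain `A₀`; `z` runs over the
closed points of `Spec A₀`, i.e. the nonzero prime ideals of `A₀`. -/
@[ext]
structure PolyhedralDivisor (A₀ : Type*) [CommRing A₀] {N : Type*} [AddCommGroup N]
    (σ : PointedCone ℚ (RatSpace N)) where
  coeff : IsDedekindDomain.HeightOneSpectrum A₀ → Set (RatSpace N)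
  isSigmaPolyhedron : ∀ z, IsSigmaPolyhedron σ (coeff z)
  finite_support : {z | coeff z ≠ (σ : Set (RatSpace N))}.Finite

namespace PolyhedralDivisor

variable {A₀ : Type*} [CommRing A₀] {N : Type*} [AddCommGroup N]
  {σ : PointedCone ℚ (RatSpace N)}

/-- The value `h_{Δ_z}(u) = min_{v ∈ Δ_z} ⟨u, v⟩` of the support function at `u ∈ σ^∨`. -/
noncomputable def supportValue (D : PolyhedralDivisor A₀ σ)
    (z : IsDedekindDomain.HeightOneSpectrum A₀) {u : DualRatSpace N} (hu : u ∈ dualCone σ) : ℚ :=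
  ((D.isSigmaPolyhedron z).exists_isLeast hu).choose

theorem isLeast_supportValue (D : PolyhedralDivisor A₀ σ)
    (z : IsDedekindDomain.HeightOneSpectrum A₀) {u : DualRatSpace N} (hu : u ∈ dualCone σ) :
    IsLeast (u '' D.coeff z) (D.supportValue z hu) :=
  ((D.isSigmaPolyhedron z).exists_isLeast hu).choose_spec

theorem supportValue_eq_zero (D : PolyhedralDivisor A₀ σ)
    {z : IsDedekindDomain.HeightOneSpectrum A₀} (hz : D.coeff z = σ)
    {u : DualRatSpace N} (hu : u ∈ dualCone σ) : D.supportValue z hu = 0 := by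
  refine (D.isLeast_supportValue z hu).unique ⟨⟨0, ?_, map_zero u⟩, ?_⟩
  · rw [hz]
    exact σ.zero_mem
  · rintro _ ⟨v, hv, rfl⟩
    rw [hz] at hv
    exact mem_dualCone.1 hu v hv

theorem supportValue_add_le (D : PolyhedralDivisor A₀ σ)
    (z : IsDedekindDomain.HeightOneSpectrum A₀) {u u' : DualRatSpace N} (hu : u ∈ dualCone σ)
    (hu' : u' ∈ dualCone σ) (huu' : u + u' ∈ dualCone σ) :
    D.supportValue z hu + D.supportValue z hu' ≤ D.supportValue z huu' := by
  obtain ⟨v, hv, h⟩ := (D.isLeast_supportValue z huu').1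
  rw [← h, LinearMap.add_apply]
  exact add_le_add ((D.isLeast_supportValue z hu).2 ⟨v, hv, rfl⟩)
    ((D.isLeast_supportValue z hu').2 ⟨v, hv, rfl⟩)

/-- The evaluation `𝔇(u) = ∑ h_{Δ_z}(u) · z` at `u ∈ σ^∨`, a rational Weil divisor. -/
noncomputable def eval (D : PolyhedralDivisor A₀ σ) {u : DualRatSpace N}
    (hu : u ∈ dualCone σ) : IsDedekindDomain.HeightOneSpectrum A₀ →₀ ℚ :=
  Finsupp.ofSupportFinite (fun z => D.supportValue z hu)
    (D.finite_support.subset fun _ hz h => hz (D.supportValue_eq_zero h hu))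

theorem eval_apply (D : PolyhedralDivisor A₀ σ) {u : DualRatSpace N}
    (hu : u ∈ dualCone σ) (z : IsDedekindDomain.HeightOneSpectrum A₀) :
    D.eval hu z = D.supportValue z hu := rfl

/-- The integral Weil divisor `⌊𝔇(u)⌋`. -/
noncomputable def floorEval (D : PolyhedralDivisor A₀ σ) {u : DualRatSpace N}
    (hu : u ∈ dualCone σ) : IsDedekindDomain.HeightOneSpectrum A₀ →₀ ℤ :=
  (D.eval hu).mapRange (fun q : ℚ => ⌊q⌋) Int.floor_zero

theorem floorEval_apply (D : PolyhedralDivisor A₀ σ) {u : DualRatSpace N}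
    (hu : u ∈ dualCone σ) (z : IsDedekindDomain.HeightOneSpectrum A₀) :
    D.floorEval hu z = ⌊D.supportValue z hu⌋ := rfl

section Algebra

variable [IsDedekindDomain A₀] (K : Type*) [Field K] [Algebra A₀ K] [IsFractionRing A₀ K]

open Classical in
/-- The graded piece `H⁰(Y, O_Y(⌊𝔇(u)⌋)) ⊆ K₀` for `u ∈ σ^∨`, and `0` for `u ∉ σ^∨`. -/
noncomputable def piece (D : PolyhedralDivisor A₀ σ) (u : DualRatSpace N) : Submodule A₀ K :=
  if hu : u ∈ dualCone σ then globalSections K (D.floorEval hu) else ⊥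

theorem mem_piece {D : PolyhedralDivisor A₀ σ} {u : DualRatSpace N} (hu : u ∈ dualCone σ)
    {f : K} : f ∈ D.piece K u ↔ (f ≠ 0 → ∀ z, 0 ≤ ordAt z f + ⌊D.supportValue z hu⌋) := by
  rw [piece, dif_pos hu, mem_globalSections]
  simp only [floorEval_apply]

theorem mem_piece_of_not_mem {D : PolyhedralDivisor A₀ σ} {u : DualRatSpace N}
    (hu : u ∉ dualCone σ) {f : K} : f ∈ D.piece K u ↔ f = 0 := by
  rw [piece, dif_neg hu, Submodule.mem_bot]

theorem one_mem_piece (D : PolyhedralDivisor A₀ σ) : (1 : K) ∈ D.piece K 0 := by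
  have h0 : (0 : DualRatSpace N) ∈ dualCone σ := (dualCone σ).zero_mem
  rw [mem_piece K h0]
  intro _ z
  obtain ⟨v, _, hv⟩ := (D.isLeast_supportValue z h0).1
  have : D.supportValue z h0 = 0 := by rw [← hv]; rfl
  simp [ordAt_one, this]

theorem mul_mem_piece (D : PolyhedralDivisor A₀ σ) {u u' : DualRatSpace N} {f g : K}
    (hf : f ∈ D.piece K u) (hg : g ∈ D.piece K u') : f * g ∈ D.piece K (u + u') := by
  by_cases hu : u ∈ dualCone σ
  · by_cases hu' : u' ∈ dualCone σ
    · have huu' := (dualCone σ).add_mem hu hu'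
      rw [piece, dif_pos hu] at hf
      rw [piece, dif_pos hu'] at hg
      rw [piece, dif_pos huu']
      refine mul_mem_globalSections (fun z => ?_) hf hg
      simp only [floorEval_apply]
      exact (Int.le_floor_add _ _).trans
        (Int.floor_le_floor (D.supportValue_add_le z hu hu' huu'))
    · rw [(mem_piece_of_not_mem K hu').1 hg, mul_zero]
      exact Submodule.zero_mem _
  · rw [(mem_piece_of_not_mem K hu).1 hf, zero_mul]
    exact Submodule.zero_mem _

/-- The algebra `A₀[𝔇] = ⨁_{m ∈ σ^∨ ∩ M} H⁰(Y, O_Y(⌊𝔇(m)⌋)) χ^m`, inside `K₀[M]`. -/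
noncomputable def sectionAlgebra (D : PolyhedralDivisor A₀ σ) :
    Subalgebra A₀ (AddMonoidAlgebra K (DualLattice N)) where
  carrier := {a | ∀ m : DualLattice N, a.coeff m ∈ D.piece K (toDualRat m)}
  algebraMap_mem' := by
    classical
    intro c m
    rw [AddMonoidAlgebra.coe_algebraMap, Function.comp_apply,
      AddMonoidAlgebra.coeff_single, Finsupp.single_apply]
    split_ifs with h
    · rw [← h, map_zero, Algebra.algebraMap_eq_smul_one]
      exact Submodule.smul_mem _ _ (D.one_mem_piece K)
    · exact Submodule.zero_mem _
  add_mem' := fun ha hb m => Submodule.add_mem _ (ha m) (hb m)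
  mul_mem' := by
    classical
    intro a b ha hb m
    rw [AddMonoidAlgebra.coeff_mul]
    refine Submodule.sum_mem _ fun x _ => Submodule.sum_mem _ fun y _ => ?_
    dsimp only
    split_ifs with h
    · rw [← h, map_add]
      exact D.mul_mem_piece K (ha x) (hb y)
    · exact Submodule.zero_mem _

theorem mem_sectionAlgebra {D : PolyhedralDivisor A₀ σ}
    {a : AddMonoidAlgebra K (DualLattice N)} :
    a ∈ D.sectionAlgebra K ↔ ∀ m : DualLattice N, a.coeff m ∈ D.piece K (toDualRat m) :=
  Iff.rfl

end Algebra

end PolyhedralDivisor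

section Graded

variable {A₀ : Type*} [CommRing A₀] {K : Type*} [Field K] [Algebra A₀ K]
  {N : Type*} [AddCommGroup N]

/-- The graded piece `A_m ⊆ K₀` of `A ⊆ K₀[M]`: the `f ∈ K₀` with `f χ^m ∈ A`. -/
noncomputable def gradedPiece (A : Subalgebra A₀ (AddMonoidAlgebra K (DualLattice N)))
    (m : DualLattice N) : Submodule A₀ K where
  carrier := {f | AddMonoidAlgebra.single m f ∈ A}
  zero_mem' := by simp
  add_mem' := by
    intro f g hf hg
    simpa [AddMonoidAlgebra.single_add] using A.add_mem hf hg
  smul_mem' := by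
    intro c f hf
    simpa [AddMonoidAlgebra.smul_single] using A.smul_mem hf c

/-- `A` is an `M`-graded subalgebra of `K₀[M]`: `A = ⨁_m A_m χ^m`, that is, each homogeneous
component of an element of `A` lies in `A`. -/
def IsGradedSubalgebra (A : Subalgebra A₀ (AddMonoidAlgebra K (DualLattice N))) : Prop :=
  ∀ a ∈ A, ∀ m, a.coeff m ∈ gradedPiece A m

/-- The weight cone of `A`: the cone of `M_ℚ` generated by the `m` with `A_m ≠ 0`. -/
noncomputable def weightCone (A : Subalgebra A₀ (AddMonoidAlgebra K (DualLattice N))) :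
    PointedCone ℚ (DualRatSpace N) :=
  PointedCone.hull ℚ (toDualRat '' {m | gradedPiece A m ≠ ⊥})

/-- `A` has the same fraction field as `K₀[M]`: the fraction field of `K₀[M]` is, via the
inclusion, a fraction field of `A`. -/
def HasFullFractionField (A : Subalgebra A₀ (AddMonoidAlgebra K (DualLattice N))) : Prop :=
  IsFractionRing A (FractionRing (AddMonoidAlgebra K (DualLattice N)))

/-- The integral closure of `A` in the fraction field of `K₀[M]`; this is the normalization
of `A` when `A` has the same fraction field as `K₀[M]`. -/
noncomputable def normalizationIn (A : Subalgebra A₀ (AddMonoidAlgebra K (DualLattice N))) :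
    Subalgebra A₀ (FractionRing (AddMonoidAlgebra K (DualLattice N))) :=
  (integralClosure A (FractionRing (AddMonoidAlgebra K (DualLattice N)))).restrictScalars A₀

/-- The image of `B ⊆ K₀[M]` in the fraction field of `K₀[M]`. -/
noncomputable def imageInFractionField
    (B : Subalgebra A₀ (AddMonoidAlgebra K (DualLattice N))) :
    Subalgebra A₀ (FractionRing (AddMonoidAlgebra K (DualLattice N))) :=
  B.map (IsScalarTower.toAlgHom A₀ (AddMonoidAlgebra K (DualLattice N))
    (FractionRing (AddMonoidAlgebra K (DualLattice N))))

end Graded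

/-- The dual in `N_ℚ` of the cone of `M_ℚ` generated by `m_1, …, m_r`. -/
noncomputable def dualOfWeights {N : Type*} [AddCommGroup N] {r : ℕ}
    (m : Fin r → DualLattice N) : PointedCone ℚ (RatSpace N) :=
  PointedCone.dual LinearMap.id
    (PointedCone.hull ℚ (Set.range fun i => toDualRat (m i)) : Set (DualRatSpace N))

/-- `Δ_z[f] = {v ∈ N_ℚ : ⟨m_i, v⟩ ≥ -ord_z f_i for all i}`. -/
noncomputable def generatorPolyhedron {A₀ : Type*} [CommRing A₀] [IsDedekindDomain A₀]
    {K : Type*} [Field K] [Algebra A₀ K] [IsFractionRing A₀ K] {N : Type*} [AddCommGroup N]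
    {r : ℕ} (f : Fin r → K) (m : Fin r → DualLattice N)
    (z : IsDedekindDomain.HeightOneSpectrum A₀) : Set (RatSpace N) :=
  {v | ∀ i, -(ordAt z (f i) : ℚ) ≤ toDualRat (m i) v}

/-!
A homogeneous element `f χ^m` lies in `A₀[𝔇]` exactly when `m ∈ σ^∨` and `0 ≤ ord_z f + ⟨m, v⟩` for
all `z` and all `v ∈ Δ_z`.

(i) A graded algebra with full fraction field is normal as soon as it contains every homogeneous
element almost integral over it, and `0 ≤ a + n b` for all `n` forces `0 ≤ b`. For noetherianity,
consider the monoid of pairs `(m, E)` of a weight `m ∈ σ^∨ ∩ M` and an integral divisor `E ≤ 𝔇(m)`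
supported on the finitely many `z` with `Δ_z ≠ σ`. By Gordan's lemma it is finitely generated, and
`H⁰(E) H⁰(E') = H⁰(E + E')`, so finitely many of the finitely generated modules `H⁰(E) χ^m` generate
`A₀[𝔇]`.

(ii), (iii) A graded noetherian algebra is generated over its degree zero piece by finitely many
monomials `f_i χ^{m_i}`. If `f χ^m ∈ A₀[𝔇[f]]`, then by linear programming duality, for each `z`
some monomial in the generators has degree `n m` and order at `z` at most that of `f ^ n`; over a
Dedekind domain these local comparisons put `f ^ n χ^{n m}` in the algebra. So `A₀[𝔇[f]]`, which is
normal, is integral over it. If `Δ_z[f]` were empty, Farkas' lemma would give an element of degree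
zero with a pole at `z`. Uniqueness holds because `Δ_z` is recovered from its support function,
which is determined by the orders at `z` of the sections of multiples of `𝔇(m)`.
-/

/-! ### Finitely generated cones and polyhedra -/

section Cones

open PointedCone

variable {𝕜 V : Type*} [Field 𝕜] [LinearOrder 𝕜] [IsStrictOrderedRing 𝕜]
  [AddCommGroup V] [Module 𝕜 V]

theorem exists_nonneg_forall_mul_le {ι : Type*} (s : Finset ι) {a b : ι → 𝕜}
    (h₀ : ∀ i ∈ s, 0 ≤ a i → 0 ≤ b i)
    (h : ∀ i ∈ s, ∀ j ∈ s, 0 < a i → a j < 0 → a j * b i ≤ a i * b j) :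
    ∃ t : 𝕜, 0 ≤ t ∧ ∀ i ∈ s, t * a i ≤ b i := by
  classical
  -- The largest of the lower bounds on `t` also satisfies all the upper bounds.
  obtain ⟨t, ht, hmax⟩ := Finset.exists_max_image
    (insert 0 ({j ∈ s | a j < 0}.image fun j => b j / a j)) id (Finset.insert_nonempty _ _)
  have ht0 : 0 ≤ t := hmax 0 (Finset.mem_insert_self _ _)
  refine ⟨t, ht0, fun i hi => ?_⟩
  rcases lt_trichotomy (a i) 0 with hneg | hzero | hpos
  · have : b i / a i ≤ t := hmax _ (Finset.mem_insert_of_mem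
      (Finset.mem_image_of_mem _ (Finset.mem_filter.2 ⟨hi, hneg⟩)))
    rwa [div_le_iff_of_neg hneg] at this
  · simpa [hzero] using h₀ i hi hzero.ge
  · rcases Finset.mem_insert.1 ht with rfl | ht
    · simpa using h₀ i hi hpos.le
    · obtain ⟨j, hj, rfl⟩ := Finset.mem_image.1 ht
      obtain ⟨hjs, hjneg⟩ := Finset.mem_filter.1 hj
      rw [div_mul_eq_mul_div, div_le_iff_of_neg hjneg]
      linarith [h i hi j hjs hpos hjneg]

/-- The inequalities obtained from `s` by Fourier–Motzkin elimination along `x`: those which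
are nonnegative at `x`, and the positive combinations of two which vanish at `x`. -/
def eliminationForms (s : Set (Module.Dual 𝕜 V)) (x : V) : Set (Module.Dual 𝕜 V) :=
  {u ∈ s | 0 ≤ u x} ∪
    Set.image2 (fun u w => u x • w - w x • u) {u ∈ s | 0 < u x} {w ∈ s | w x < 0}

theorem mem_dual_eliminationForms {s : Set (Module.Dual 𝕜 V)} {x y : V} :
    y ∈ dual .id (eliminationForms s x) ↔ (∀ u ∈ s, 0 ≤ u x → 0 ≤ u y) ∧
      ∀ u ∈ s, ∀ w ∈ s, 0 < u x → w x < 0 → w x * u y ≤ u x * w y := by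
  rw [eliminationForms, dual_union, Submodule.mem_inf]
  refine and_congr ?_ ?_
  · simp only [mem_dual, Set.mem_ofPred_eq, LinearMap.id_apply, and_imp]
  · simp only [mem_dual, Set.forall_mem_image2, Set.mem_ofPred_eq, LinearMap.id_apply,
      LinearMap.sub_apply, LinearMap.smul_apply, smul_eq_mul, sub_nonneg, and_imp]
    exact forall₂_congr fun u _ => ⟨fun h w hw hu hwx => h hu w hw hwx,
      fun h hu w hw hwx => h w hw hu hwx⟩

theorem hull_singleton_sup_dual_eq_dual_eliminationForms (s : Finset (Module.Dual 𝕜 V)) (x : V) :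
    hull 𝕜 {x} ⊔ dual .id (s : Set (Module.Dual 𝕜 V)) =
      dual .id (eliminationForms (s : Set (Module.Dual 𝕜 V)) x) := by
  refine le_antisymm (sup_le (Submodule.span_le.2 (Set.singleton_subset_iff.2 ?_)) ?_) ?_
  · exact mem_dual_eliminationForms.2
      ⟨fun _ _ h => h, fun u _ w _ _ _ => (mul_comm (w x) (u x)).le⟩
  · intro y hy
    refine mem_dual_eliminationForms.2 ⟨fun u hu _ => hy hu, fun u hu w hw hux hwx => ?_⟩
    exact (mul_nonpos_of_nonpos_of_nonneg hwx.le (hy hu)).trans (mul_nonneg hux.le (hy hw))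
  · intro y hy
    obtain ⟨h₀, h⟩ := mem_dual_eliminationForms.1 hy
    obtain ⟨t, ht, hty⟩ := exists_nonneg_forall_mul_le s h₀ h
    rw [← add_sub_cancel (t • x) y]
    refine Submodule.add_mem_sup (PointedCone.smul_mem _ ht (subset_hull rfl)) fun u hu => ?_
    simpa using hty u hu

theorem dualFG_hull_singleton_sup {C : PointedCone 𝕜 V} (hC : C.DualFG .id) (x : V) :
    (hull 𝕜 {x} ⊔ C).DualFG .id := by
  obtain ⟨s, rfl⟩ := hC
  rw [hull_singleton_sup_dual_eq_dual_eliminationForms]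
  exact DualFG.dual_of_finite _ ((s.finite_toSet.subset fun _ hu => hu.1).union
    ((s.finite_toSet.subset fun _ hu => hu.1).image2 _ (s.finite_toSet.subset fun _ hu => hu.1)))

section FiniteDimensional

variable [FiniteDimensional 𝕜 V]

variable (𝕜 V) in
theorem dualFG_bot : (⊥ : PointedCone 𝕜 V).DualFG .id := by
  let b := Module.finBasis 𝕜 V
  have hfin : (Set.range b.coord ∪ Set.range fun i => -b.coord i).Finite :=
    (Set.finite_range _).union (Set.finite_range _)
  convert DualFG.dual_of_finite .id hfin
  refine le_antisymm bot_le fun y hy => (Submodule.mem_bot _).2 (b.ext_elem fun i => ?_)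
  have hpos : 0 ≤ b.coord i y := hy (Or.inl ⟨i, rfl⟩)
  have hneg : 0 ≤ -b.coord i y := hy (Or.inr ⟨i, rfl⟩)
  simpa using le_antisymm (neg_nonneg.1 hneg) hpos

theorem dualFG_id_of_fg {C : PointedCone 𝕜 V} (hC : C.FG) : C.DualFG .id := by
  classical
  obtain ⟨s, rfl⟩ := hC
  induction s using Finset.induction_on with
  | empty => simpa using dualFG_bot 𝕜 V
  | insert a s _ ih =>
    rw [Finset.coe_insert, Submodule.span_insert]
    exact dualFG_hull_singleton_sup ih a

theorem dual_id_dual_eval_of_fg {C : PointedCone 𝕜 V} (hC : C.FG) :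
    dual .id (dual (Module.Dual.eval 𝕜 V) (C : Set V) : Set (Module.Dual 𝕜 V)) = C :=
  (dualFG_id_of_fg hC).dual_dual_flip

theorem dualFG_eval_of_fg {C : PointedCone 𝕜 (Module.Dual 𝕜 V)} (hC : C.FG) :
    C.DualFG (Module.Dual.eval 𝕜 V) := by
  classical
  obtain ⟨s, rfl⟩ := dualFG_id_of_fg hC
  refine ⟨s.image (Module.evalEquiv 𝕜 V).symm, ?_⟩
  ext u
  simp only [Finset.coe_image, mem_dual, Set.forall_mem_image, Module.Dual.eval_apply,
    Module.apply_evalEquiv_symm_apply, LinearMap.id_apply]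

theorem dual_eval_dual_id_of_fg {C : PointedCone 𝕜 (Module.Dual 𝕜 V)} (hC : C.FG) :
    dual (Module.Dual.eval 𝕜 V) (dual .id (C : Set (Module.Dual 𝕜 V)) : Set V) = C :=
  (dualFG_eval_of_fg hC).dual_dual_flip

theorem fg_of_dualFG_id {C : PointedCone 𝕜 V} (hC : C.DualFG .id) : C.FG := by
  obtain ⟨D, hD, rfl⟩ := hC.exists_fg_dual
  obtain ⟨E, hE, rfl⟩ := (dualFG_eval_of_fg hD).exists_fg_dual
  rwa [dual_id_dual_eval_of_fg hE]

theorem exists_nonneg_sum_smul_eq {ι : Type*} [Fintype ι] (g : ι → Module.Dual 𝕜 V)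
    (w : Module.Dual 𝕜 V) (h : ∀ v, (∀ i, 0 ≤ g i v) → 0 ≤ w v) :
    ∃ l : ι → 𝕜, (∀ i, 0 ≤ l i) ∧ ∑ i, l i • g i = w := by
  have hfg : (hull 𝕜 (Set.range g)).FG := Submodule.fg_span (Set.finite_range g)
  have hw : w ∈ hull 𝕜 (Set.range g) := by
    rw [← dual_eval_dual_id_of_fg hfg]
    exact fun v hv => h v fun i => hv (subset_hull ⟨i, rfl⟩)
  obtain ⟨l, hl⟩ := (Submodule.mem_span_range_iff_exists_fun _).1 hw
  exact ⟨fun i => l i, fun i => (l i).2, hl⟩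

end FiniteDimensional

/-- The linear forms on `V × 𝕜` which cut out the cone over the polyhedron `{v | c ≤ u v}`, the
height being the second coordinate; `none` is the condition that the height is nonnegative. -/
def homogenization {ι : Type*} (u : ι → Module.Dual 𝕜 V) (c : ι → 𝕜) :
    Option ι → Module.Dual 𝕜 (V × 𝕜)
  | none => LinearMap.snd 𝕜 V 𝕜
  | some i => (u i).coprod (-c i • LinearMap.id)

theorem forall_homogenization_nonneg_iff {ι : Type*} {u : ι → Module.Dual 𝕜 V} {c : ι → 𝕜}
    {x : V × 𝕜} :
    (∀ o, 0 ≤ homogenization u c o x) ↔ 0 ≤ x.2 ∧ ∀ i, x.2 * c i ≤ u i x.1 := by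
  rw [Option.forall]
  refine and_congr Iff.rfl (forall_congr' fun i => ?_)
  simp [homogenization, mul_comm]

theorem mul_le_of_forall_le {ι : Type*} {u : ι → Module.Dual 𝕜 V} {c : ι → 𝕜}
    {w : Module.Dual 𝕜 V} {d : 𝕜}
    (h : ∀ v, (∀ i, c i ≤ u i v) → d ≤ w v) {v : V} {t : 𝕜} (ht : 0 < t)
    (hv : ∀ i, t * c i ≤ u i v) : t * d ≤ w v := by
  have := h (t⁻¹ • v) fun i => by
    rw [map_smul, smul_eq_mul, ← div_eq_inv_mul, le_div_iff₀' ht]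
    exact hv i
  rwa [map_smul, smul_eq_mul, ← div_eq_inv_mul, le_div_iff₀' ht] at this

theorem nonneg_of_forall_nonneg_add_mul {a b : 𝕜} (h : ∀ t, 0 ≤ t → 0 ≤ a + t * b) : 0 ≤ b := by
  by_contra! hb
  have := h ((|a| + 1) / -b) (div_nonneg (by positivity) (by linarith))
  rw [div_mul_eq_mul_div, div_neg, mul_div_cancel_right₀ _ hb.ne] at this
  linarith [le_abs_self a]

section Duality

variable [FiniteDimensional 𝕜 V] {ι : Type*} [Fintype ι]

theorem exists_nonneg_sum_smul_eq_of_homogenization (u : ι → Module.Dual 𝕜 V) (c : ι → 𝕜)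
    (w : Module.Dual 𝕜 V) (d : 𝕜)
    (h : ∀ (v : V) (t : 𝕜), 0 ≤ t → (∀ i, t * c i ≤ u i v) → t * d ≤ w v) :
    ∃ l : ι → 𝕜, (∀ i, 0 ≤ l i) ∧ ∑ i, l i • u i = w ∧ d ≤ ∑ i, l i * c i := by
  obtain ⟨l, hl, hw⟩ := exists_nonneg_sum_smul_eq (homogenization u c)
    (w.coprod (-d • LinearMap.id)) fun x hx => by
      obtain ⟨ht, hx⟩ := forall_homogenization_nonneg_iff.1 hx
      simpa [mul_comm] using h x.1 x.2 ht hx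
  rw [Fintype.sum_option] at hw
  refine ⟨fun i => l (some i), fun i => hl _, ?_, ?_⟩
  · ext v
    simpa [homogenization, LinearMap.sum_apply] using LinearMap.congr_fun hw (v, 0)
  · have hheight : l none - ∑ i, l (some i) * c i = -d := by
      simpa [homogenization, LinearMap.sum_apply, ← sub_eq_add_neg] using
        LinearMap.congr_fun hw (0, 1)
    linarith [hl none]

theorem exists_nonneg_sum_smul_eq_of_forall_le (u : ι → Module.Dual 𝕜 V) (c : ι → 𝕜)
    (hne : ∃ v, ∀ i, c i ≤ u i v) (w : Module.Dual 𝕜 V) (d : 𝕜)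
    (h : ∀ v, (∀ i, c i ≤ u i v) → d ≤ w v) :
    ∃ l : ι → 𝕜, (∀ i, 0 ≤ l i) ∧ ∑ i, l i • u i = w ∧ d ≤ ∑ i, l i * c i := by
  obtain ⟨v₀, hv₀⟩ := hne
  refine exists_nonneg_sum_smul_eq_of_homogenization u c w d fun v t ht hv => ?_
  rcases ht.eq_or_lt with rfl | ht
  · simp only [zero_mul] at hv ⊢
    refine nonneg_of_forall_nonneg_add_mul (a := w v₀ - d) fun s hs => ?_
    have := h (v₀ + s • v) fun i => by
      rw [map_add, map_smul, smul_eq_mul]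
      linarith [hv₀ i, mul_nonneg hs (hv i)]
    rw [map_add, map_smul, smul_eq_mul] at this
    linarith
  · exact mul_le_of_forall_le h ht hv

theorem exists_nonneg_sum_smul_eq_zero_of_infeasible (u : ι → Module.Dual 𝕜 V) (c : ι → 𝕜)
    (h : ¬ ∃ v, ∀ i, c i ≤ u i v) :
    ∃ l : ι → 𝕜, (∀ i, 0 ≤ l i) ∧ ∑ i, l i • u i = 0 ∧ 0 < ∑ i, l i * c i := by
  obtain ⟨l, hl, hu, hc⟩ := exists_nonneg_sum_smul_eq_of_homogenization u c 0 1
    fun v t ht hv => by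
      rcases ht.eq_or_lt with rfl | ht
      · simp
      · exact mul_le_of_forall_le (fun v hv => absurd ⟨v, hv⟩ h) ht hv
  exact ⟨l, hl, hu, zero_lt_one.trans_le hc⟩

end Duality

/-- The cone in `V × 𝕜` over `P + σ`, where `P` is a nonempty convex set: it is `t • P + σ` at
height `t ≥ 0`, and in particular `σ` at height `0`. -/
def coneOver (P : Set V) (hP : Convex 𝕜 P) (hne : P.Nonempty) (σ : PointedCone 𝕜 V) :
    PointedCone 𝕜 (V × 𝕜) where
  carrier := {x | 0 ≤ x.2 ∧ x.1 ∈ x.2 • P + (σ : Set V)}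
  zero_mem' := ⟨le_rfl, 0, hne.imp fun _ hp => ⟨hp, zero_smul _ _⟩, 0, σ.zero_mem, add_zero _⟩
  add_mem' := by
    rintro x y ⟨hx0, a, ha, s, hs, hx⟩ ⟨hy0, b, hb, t, ht, hy⟩
    refine ⟨add_nonneg hx0 hy0, a + b, ?_, s + t, σ.add_mem hs ht, ?_⟩
    · rw [Prod.snd_add, hP.add_smul hx0 hy0]
      exact Set.add_mem_add ha hb
    · rw [Prod.fst_add, ← hx, ← hy]
      exact add_add_add_comm a b s t
  smul_mem' := by
    rintro c x ⟨hx0, _, ⟨p, hp, rfl⟩, s, hs, hx⟩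
    refine ⟨mul_nonneg c.2 hx0, (c : 𝕜) • x.2 • p, ⟨p, hp, mul_smul _ _ _⟩,
      (c : 𝕜) • s, σ.smul_mem c.2 hs, ?_⟩
    rw [Prod.smul_fst, ← hx, Nonneg.mk_smul, smul_add]

section ConeOver

variable {P : Set V} {hP : Convex 𝕜 P} {hne : P.Nonempty} {σ : PointedCone 𝕜 V}

theorem mk_one_mem_coneOver {v : V} : (v, 1) ∈ coneOver P hP hne σ ↔ v ∈ P + (σ : Set V) := by
  change 0 ≤ (1 : 𝕜) ∧ v ∈ (1 : 𝕜) • P + (σ : Set V) ↔ _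
  rw [one_smul, and_iff_right zero_le_one]

theorem mk_zero_mem_coneOver {v : V} (hv : v ∈ σ) : (v, 0) ∈ coneOver P hP hne σ :=
  ⟨le_rfl, 0, hne.imp fun _ hp => ⟨hp, zero_smul _ _⟩, v, hv, zero_add v⟩

theorem mem_coneOver_of_inv_smul_mem {x : V × 𝕜} (hx : 0 < x.2) (hxP : x.2⁻¹ • x.1 ∈ P) :
    x ∈ coneOver P hP hne σ :=
  ⟨hx.le, x.1, (Set.mem_smul_set_iff_inv_smul_mem₀ hx.ne' _ _).2 hxP, 0, σ.zero_mem, add_zero _⟩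

end ConeOver

theorem convexHull_add_dual_subset {ι : Type*} {u : ι → Module.Dual 𝕜 V} {c : ι → 𝕜} {Q : Set V}
    (hQ : ∀ q ∈ Q, ∀ i, c i ≤ u i q) :
    convexHull 𝕜 Q + (dual .id (Set.range u) : Set V) ⊆ {v | ∀ i, c i ≤ u i v} := by
  rintro _ ⟨a, ha, s, hs, rfl⟩ i
  have hai : a ∈ {v | c i ≤ u i v} :=
    convexHull_min (fun q hq => hQ q hq i) (convex_halfSpace_ge (u i).isLinear (c i)) ha
  have hsi : 0 ≤ u i s := hs ⟨i, rfl⟩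
  rw [map_add]
  exact le_add_of_le_of_nonneg hai hsi

variable [FiniteDimensional 𝕜 V]

/-- In the Minkowski–Weyl decomposition, the polytope part is spanned by the generators of positive
height of the cone over the polyhedron, rescaled to height one. -/
theorem exists_finite_convexHull_add_dual_eq {ι : Type*} [Finite ι] (u : ι → Module.Dual 𝕜 V)
    (c : ι → 𝕜) (hne : ∃ v, ∀ i, c i ≤ u i v) :
    ∃ Q : Set V, Q.Finite ∧ Q.Nonempty ∧
      {v | ∀ i, c i ≤ u i v} = convexHull 𝕜 Q + (dual .id (Set.range u) : Set V) := by
  obtain ⟨S, hS⟩ := fg_of_dualFG_id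
    (DualFG.dual_of_finite .id (Set.finite_range (homogenization u c)))
  have hmem (x : V × 𝕜) :
      x ∈ hull 𝕜 (S : Set (V × 𝕜)) ↔ 0 ≤ x.2 ∧ ∀ i, x.2 * c i ≤ u i x.1 := by
    rw [hull, hS, mem_dual, Set.forall_mem_range]
    exact forall_homogenization_nonneg_iff
  have hgen (s) (hs : s ∈ S) := (hmem s).1 (subset_hull hs)
  have hlift {v} (hv : ∀ i, c i ≤ u i v) : (v, 1) ∈ hull 𝕜 (S : Set (V × 𝕜)) :=
    (hmem _).2 ⟨zero_le_one, by simpa using hv⟩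
  let Q : Set V := (fun s : V × 𝕜 => s.2⁻¹ • s.1) '' {s ∈ (S : Set (V × 𝕜)) | 0 < s.2}
  have hQne : Q.Nonempty := by
    refine Set.Nonempty.image _ (Set.nonempty_iff_ne_empty.2 fun hempty => ?_)
    have hker : hull 𝕜 (S : Set (V × 𝕜)) ≤
        ofSubmodule (LinearMap.ker (LinearMap.snd 𝕜 V 𝕜)) := Submodule.span_le.2 fun s hs =>
      ((hgen s hs).1.eq_or_lt.resolve_right fun hpos =>
        (hempty ▸ ⟨hs, hpos⟩ : s ∈ (∅ : Set (V × 𝕜)))).symm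
    obtain ⟨v, hv⟩ := hne
    exact one_ne_zero (hker (hlift hv))
  refine ⟨Q, (S.finite_toSet.subset fun s hs => hs.1).image _, hQne,
    Set.Subset.antisymm (fun v hv => ?_) (convexHull_add_dual_subset ?_)⟩
  · have hle : hull 𝕜 (S : Set (V × 𝕜)) ≤ coneOver (convexHull 𝕜 Q) (convex_convexHull 𝕜 Q)
        hQne.convexHull (dual .id (Set.range u)) := Submodule.span_le.2 fun s hs => by
      rcases (hgen s hs).1.eq_or_lt with h0 | hpos
      · rw [← Prod.mk.eta (p := s), ← h0]
        exact mk_zero_mem_coneOver (by simpa [← h0] using (hgen s hs).2)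
      · exact mem_coneOver_of_inv_smul_mem hpos (subset_convexHull 𝕜 Q ⟨s, ⟨hs, hpos⟩, rfl⟩)
    exact mk_one_mem_coneOver.1 (hle (hlift hv))
  · rintro _ ⟨s, ⟨hs, hpos⟩, rfl⟩ i
    rw [map_smul, smul_eq_mul, ← div_eq_inv_mul, le_div_iff₀' hpos]
    exact (hgen s hs).2 i

theorem exists_dual_nonneg_lt_of_notMem_convexHull_add {Q : Set V} (hQ : Q.Finite)
    (hne : Q.Nonempty) {σ : PointedCone 𝕜 V} (hσ : σ.FG) {v : V}
    (hv : v ∉ convexHull 𝕜 Q + (σ : Set V)) :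
    ∃ u : Module.Dual 𝕜 V, (∀ s ∈ σ, 0 ≤ u s) ∧ ∀ q ∈ Q, u v < u q := by
  let S : PointedCone 𝕜 (V × 𝕜) :=
    hull 𝕜 ((fun q => (q, 1)) '' Q) ⊔ σ.map (LinearMap.inl 𝕜 V 𝕜)
  have hS : S.FG := (Submodule.fg_span (hQ.image _)).sup (hσ.map _)
  have hvS : (v, 1) ∉ S := by
    have hle : S ≤ coneOver (convexHull 𝕜 Q) (convex_convexHull 𝕜 Q) hne.convexHull σ := by
      refine sup_le (Submodule.span_le.2 ?_) ?_
      · rintro _ ⟨q, hq, rfl⟩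
        exact mem_coneOver_of_inv_smul_mem zero_lt_one
          (by simpa using subset_convexHull 𝕜 Q hq)
      · rintro _ ⟨s, hs, rfl⟩
        exact mk_zero_mem_coneOver hs
    exact fun h => hv (mk_one_mem_coneOver.1 (hle h))
  rw [← dual_id_dual_eval_of_fg hS, mem_dual] at hvS
  push Not at hvS
  obtain ⟨G, hG, hGv⟩ := hvS
  have hsplit (x : V) : G (x, 1) = G (x, 0) + G (0, 1) := by rw [← map_add]; simp
  refine ⟨G ∘ₗ LinearMap.inl 𝕜 V 𝕜,
    fun s hs => hG (Submodule.mem_sup_right ⟨s, hs, rfl⟩), fun q hq => ?_⟩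
  have hGq : 0 ≤ G (q, 1) := hG (Submodule.mem_sup_left (subset_hull ⟨q, hq, rfl⟩))
  have hGv : G (v, 1) < 0 := hGv
  rw [hsplit] at hGq hGv
  change G (v, 0) < G (q, 0)
  linarith

end Cones

section Lattice

theorem exists_pos_forall_mul_eq_intCast {ι : Type*} [Finite ι] (c : ι → ℚ) :
    ∃ k : ℕ, 0 < k ∧ ∃ a : ι → ℤ, ∀ i, (a i : ℚ) = k * c i := by
  obtain ⟨⟨b, hb⟩, hint⟩ := IsLocalization.exist_integer_multiples_of_finite (nonZeroDivisors ℤ) c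
  choose a ha using hint
  refine ⟨b.natAbs, Int.natAbs_pos.2 (nonZeroDivisors.ne_zero hb), fun i => b.sign * a i,
    fun i => ?_⟩
  have hai : (a i : ℚ) = b * c i := by simpa using ha i
  rw [Int.cast_mul, hai, ← mul_assoc, ← Int.cast_mul, Int.sign_mul_self_eq_natAbs,
    Int.cast_natCast]

theorem exists_pos_forall_mul_eq_natCast {ι : Type*} [Finite ι] {c : ι → ℚ} (hc : ∀ i, 0 ≤ c i) :
    ∃ k : ℕ, 0 < k ∧ ∃ a : ι → ℕ, ∀ i, (a i : ℚ) = k * c i := by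
  obtain ⟨k, hk, a, ha⟩ := exists_pos_forall_mul_eq_intCast c
  lift a to ι → ℕ using fun i => by
    exact_mod_cast (ha i).symm ▸ mul_nonneg (Nat.cast_nonneg k) (hc i)
  exact ⟨k, hk, a, by simpa using ha⟩

variable {N : Type*} [AddCommGroup N]

theorem exists_pos_smul_eq_tmul (v : RatSpace N) :
    ∃ k : ℕ, 0 < k ∧ ∃ n : N, (k : ℚ) • v = (1 : ℚ) ⊗ₜ[ℤ] n := by
  induction v using TensorProduct.induction_on with
  | zero => exact ⟨1, one_pos, 0, by simp⟩
  | tmul q n =>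
    refine ⟨q.den, q.den_pos, q.num • n, ?_⟩
    rw [TensorProduct.smul_tmul', TensorProduct.tmul_smul, TensorProduct.smul_tmul', smul_eq_mul,
      Rat.den_mul_eq_num, zsmul_eq_mul, mul_one]
  | add x y hx hy =>
    obtain ⟨k, hk, n, hn⟩ := hx
    obtain ⟨l, hl, m, hm⟩ := hy
    refine ⟨k * l, mul_pos hk hl, (l : ℤ) • n + (k : ℤ) • m, ?_⟩
    calc ((k * l : ℕ) : ℚ) • (x + y) = (l : ℤ) • ((k : ℚ) • x) + (k : ℤ) • ((l : ℚ) • y) := by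
          push_cast
          module
      _ = (1 : ℚ) ⊗ₜ[ℤ] ((l : ℤ) • n + (k : ℤ) • m) := by
          rw [hn, hm, TensorProduct.tmul_add, TensorProduct.tmul_smul, TensorProduct.tmul_smul]

theorem exists_pos_forall_eq_mul_toDualRat (v : RatSpace N) :
    ∃ k : ℕ, 0 < k ∧ ∃ l : DualLattice N →+ ℤ, ∀ m, (l m : ℚ) = k * toDualRat m v := by
  obtain ⟨k, hk, n, hn⟩ := exists_pos_smul_eq_tmul v
  refine ⟨k, hk, (LinearMap.applyₗ n).toAddMonoidHom, fun m => ?_⟩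
  rw [← smul_eq_mul, ← map_smul, hn, toDualRat_tmul]
  simp

theorem toDualRat_injective : Function.Injective (toDualRat (N := N)) := by
  intro m m' h
  ext n
  simpa [toDualRat_tmul] using LinearMap.congr_fun h ((1 : ℚ) ⊗ₜ[ℤ] n)

theorem exists_pos_smul_eq_toDualRat [Module.Free ℤ N] [Module.Finite ℤ N] (u : DualRatSpace N) :
    ∃ k : ℕ, 0 < k ∧ ∃ m : DualLattice N, (k : ℚ) • u = toDualRat m := by
  let b := Module.finBasis ℤ N
  obtain ⟨k, hk, a, ha⟩ := exists_pos_forall_mul_eq_intCast fun i => u ((1 : ℚ) ⊗ₜ[ℤ] b i)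
  refine ⟨k, hk, b.constr ℤ a, TensorProduct.AlgebraTensorModule.curry_injective
    (LinearMap.ext_ring (b.ext fun i => ?_))⟩
  have : toDualRat (b.constr ℤ a) ((1 : ℚ) ⊗ₜ[ℤ] b i) = k * u ((1 : ℚ) ⊗ₜ[ℤ] b i) := by
    rw [toDualRat_tmul, b.constr_basis, ha, one_mul]
  simpa using this.symm

theorem fg_of_forall_mem_iff_nonneg {G ι : Type*} [AddCommGroup G] [AddGroup.FG G] [Finite ι]
    (l : ι → G →+ ℤ) {S : AddSubmonoid G} (hS : ∀ x, x ∈ S ↔ ∀ i, 0 ≤ l i x) : S.FG := by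
  have : Module.Finite ℕ G :=
    Module.Finite.iff_addMonoid_fg.2 (AddGroup.fg_iff_addMonoid_fg.1 inferInstance)
  obtain ⟨n, π, hπ⟩ := Module.Finite.exists_fin' ℕ G
  -- Slack variables turn the inequalities into equations between natural numbers.
  let value : (Fin n → ℕ) × (ι → ℕ) →+ (ι → ℤ) :=
    (AddMonoidHom.pi fun i => (l i).comp π.toAddMonoidHom).comp (AddMonoidHom.fst _ _)
  let slack : (Fin n → ℕ) × (ι → ℕ) →+ (ι → ℤ) :=
    (AddMonoidHom.pi fun i => (Nat.castAddMonoidHom ℤ).comp (Pi.evalAddMonoidHom _ i)).comp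
      (AddMonoidHom.snd _ _)
  convert (AddSubmonoid.fg_eqLocusM value slack).map
    (π.toAddMonoidHom.comp (AddMonoidHom.fst _ _))
  ext x
  rw [hS, AddSubmonoid.mem_map]
  constructor
  · intro hx
    obtain ⟨a, rfl⟩ := hπ x
    exact ⟨(a, fun i => (l i (π a)).toNat), funext fun i => (Int.toNat_of_nonneg (hx i)).symm, rfl⟩
  · rintro ⟨⟨a, y⟩, hy, rfl⟩ i
    have hyi : l i (π a) = y i := congrFun hy i
    exact hyi ▸ Int.natCast_nonneg (y i)

end Lattice

section DedekindOrder

open IsDedekindDomain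

variable {A₀ : Type*} [CommRing A₀] [IsDedekindDomain A₀]
  {K : Type*} [Field K] [Algebra A₀ K] [IsFractionRing A₀ K]

theorem ordAt_inv (z : HeightOneSpectrum A₀) (f : K) : ordAt z f⁻¹ = -ordAt z f := by
  rw [ordAt, map_inv₀, WithZero.log_inv, ordAt]

theorem ordAt_div (z : HeightOneSpectrum A₀) {f g : K} (hf : f ≠ 0) (hg : g ≠ 0) :
    ordAt z (f / g) = ordAt z f - ordAt z g := by
  rw [div_eq_mul_inv, ordAt_mul z hf (inv_ne_zero hg), ordAt_inv, sub_eq_add_neg]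

theorem ordAt_pow (z : HeightOneSpectrum A₀) (f : K) (n : ℕ) :
    ordAt z (f ^ n) = n * ordAt z f := by
  rw [ordAt, map_pow, WithZero.log_pow, ordAt, nsmul_eq_mul, mul_neg]

theorem ordAt_prod_pow (z : HeightOneSpectrum A₀) {ι : Type*} (s : Finset ι) (f : ι → K)
    (n : ι → ℕ) (hf : ∀ i ∈ s, f i ≠ 0) :
    ordAt z (∏ i ∈ s, f i ^ n i) = ∑ i ∈ s, n i * ordAt z (f i) := by
  classical
  induction s using Finset.induction_on with
  | empty => simp [ordAt_one]
  | insert a s ha ih =>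
    rw [Finset.prod_insert ha, Finset.sum_insert ha, ordAt_mul, ordAt_pow,
      ih fun i hi => hf i (Finset.mem_insert_of_mem hi)]
    · exact pow_ne_zero _ (hf a (Finset.mem_insert_self a s))
    · exact Finset.prod_ne_zero_iff.2 fun i hi =>
        pow_ne_zero _ (hf i (Finset.mem_insert_of_mem hi))

theorem ordAt_nonneg_iff (z : HeightOneSpectrum A₀) {f : K} (hf : f ≠ 0) :
    0 ≤ ordAt z f ↔ z.valuation K f ≤ 1 := by
  simpa using neg_le_ordAt_iff z hf 0

theorem natCast_le_ordAt_iff (z : HeightOneSpectrum A₀) {a : A₀} (ha : a ≠ 0) (n : ℕ) :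
    (n : ℤ) ≤ ordAt z (algebraMap A₀ K a) ↔ a ∈ z.asIdeal ^ n := by
  have h0 : algebraMap A₀ K a ≠ 0 := by simpa using ha
  have := neg_le_ordAt_iff z h0 (-n)
  rw [neg_neg] at this
  rw [this, HeightOneSpectrum.valuation_of_algebraMap,
    HeightOneSpectrum.intValuation_le_pow_iff_mem]

theorem ordAt_algebraMap_nonneg (z : HeightOneSpectrum A₀) {a : A₀} (ha : a ≠ 0) :
    0 ≤ ordAt z (algebraMap A₀ K a) :=
  (ordAt_nonneg_iff z (by simpa using ha)).2 (z.valuation_le_one a)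

theorem finite_ordAt_algebraMap_ne_zero {a : A₀} (ha : a ≠ 0) :
    {z : HeightOneSpectrum A₀ | ordAt z (algebraMap A₀ K a) ≠ 0}.Finite := by
  refine (Ideal.finite_factors (I := Ideal.span {a}) (by simpa using ha)).subset fun z hz => ?_
  have hpos : ((1 : ℕ) : ℤ) ≤ ordAt z (algebraMap A₀ K a) := by
    exact_mod_cast (ordAt_algebraMap_nonneg z ha).lt_of_ne' hz
  rw [natCast_le_ordAt_iff z ha, pow_one] at hpos
  exact Ideal.dvd_span_singleton.2 hpos

theorem finite_ordAt_ne_zero {f : K} (hf : f ≠ 0) :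
    {z : HeightOneSpectrum A₀ | ordAt z f ≠ 0}.Finite := by
  obtain ⟨a, b, hb, rfl⟩ := IsFractionRing.div_surjective (A := A₀) f
  have hb0 := nonZeroDivisors.ne_zero hb
  have ha0 : a ≠ 0 := by
    rintro rfl
    simp at hf
  refine ((finite_ordAt_algebraMap_ne_zero (K := K) ha0).union
    (finite_ordAt_algebraMap_ne_zero (K := K) hb0)).subset fun z hz => ?_
  by_contra h
  simp only [Set.mem_union, Set.mem_ofPred_eq, not_or, not_not] at h
  refine hz ?_
  rw [ordAt_div z (by simpa using ha0) (by simpa using hb0), h.1, h.2, sub_zero]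

theorem mem_span_of_forall_exists_ordAt_le {s : Set K} (hs : ∃ g ∈ s, g ≠ 0) {x : K} (hx : x ≠ 0)
    (h : ∀ z : HeightOneSpectrum A₀, ∃ g ∈ s, g ≠ 0 ∧ ordAt z g ≤ ordAt z x) :
    x ∈ Submodule.span A₀ s := by
  -- It suffices that the ideal of denominators of `x` lies in no maximal ideal.
  let I : Ideal A₀ := (Submodule.span A₀ s).comap (LinearMap.toSpanSingleton A₀ K x)
  have mem_of_mul_eq {g : K} (hg : g ∈ s) (hg0 : g ≠ 0) {d n : A₀}
      (hdn : x / g * algebraMap A₀ K d = algebraMap A₀ K n) : d ∈ I := by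
    have hdx : d • x = n • g := by
      rw [Algebra.smul_def, Algebra.smul_def, ← hdn]
      field_simp
    exact (hdx ▸ Submodule.smul_mem _ n (Submodule.subset_span hg) :
      d • x ∈ Submodule.span A₀ s)
  suffices hI : I = ⊤ by
    have h1 : (1 : A₀) • x ∈ Submodule.span A₀ s := (Ideal.eq_top_iff_one I).1 hI
    rwa [one_smul] at h1
  by_contra hI
  obtain ⟨P, hP, hIP⟩ := Ideal.exists_le_maximal I hI
  by_cases hP0 : P = ⊥
  · obtain ⟨g, hg, hg0⟩ := hs
    obtain ⟨n, d, hd, hnd⟩ := IsFractionRing.div_surjective (A := A₀) (x / g)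
    have hd0 : d ≠ 0 := nonZeroDivisors.ne_zero hd
    have hdP : d ∈ P := hIP (mem_of_mul_eq hg hg0 (n := n) (by
      rw [← hnd, div_mul_cancel₀]
      simpa using hd0))
    exact hd0 (by simpa [hP0] using hdP)
  · let z : HeightOneSpectrum A₀ := ⟨P, hP.isPrime, hP0⟩
    obtain ⟨g, hg, hg0, hle⟩ := h z
    obtain ⟨n, d, hnd⟩ := HeightOneSpectrum.exists_primeCompl_mul_eq_of_integer (K := K) z (x / g)
      ((ordAt_nonneg_iff z (div_ne_zero hx hg0)).1 (by rw [ordAt_div z hx hg0]; linarith))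
    exact d.2 (hIP (mem_of_mul_eq hg hg0 hnd))

theorem exists_forall_mem_pow_notMem_pow_succ (E : HeightOneSpectrum A₀ →₀ ℕ)
    (z₀ : HeightOneSpectrum A₀) :
    ∃ a : A₀, (∀ z : HeightOneSpectrum A₀, a ∈ z.asIdeal ^ E z) ∧
      a ∉ z₀.asIdeal ^ (E z₀ + 1) := by
  classical
  obtain ⟨c, hc, hc'⟩ := SetLike.exists_of_lt
    (Ideal.pow_right_strictAnti z₀.asIdeal z₀.ne_bot z₀.isPrime.ne_top (Nat.lt_succ_self (E z₀)))
  obtain ⟨a, ha⟩ := IsDedekindDomain.exists_forall_sub_mem_ideal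
    (s := insert z₀ E.support) (fun z : HeightOneSpectrum A₀ => z.asIdeal)
    (Function.update E z₀ (E z₀ + 1)) (fun z _ => z.prime)
    (fun z _ w _ hzw h => hzw (HeightOneSpectrum.ext h))
    (fun z => if (z : HeightOneSpectrum A₀) = z₀ then c else 0)
  have ha₀ : a - c ∈ z₀.asIdeal ^ (E z₀ + 1) := by
    simpa using ha z₀ (Finset.mem_insert_self _ _)
  refine ⟨a, fun z => ?_, fun h => hc' ?_⟩
  · by_cases hz : z = z₀
    · subst hz
      simpa using Ideal.add_mem _ (Ideal.pow_le_pow_right (Nat.le_succ _) ha₀) hc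
    · by_cases hzE : z ∈ E.support
      · simpa [hz] using ha z (Finset.mem_insert_of_mem hzE)
      · simp [Finsupp.notMem_support_iff.1 hzE]
  · simpa using Ideal.sub_mem _ h ha₀

theorem exists_ordAt_algebraMap_eq (E : HeightOneSpectrum A₀ →₀ ℕ) (z₀ : HeightOneSpectrum A₀) :
    ∃ a : A₀, a ≠ 0 ∧ (∀ z, (E z : ℤ) ≤ ordAt z (algebraMap A₀ K a)) ∧
      ordAt z₀ (algebraMap A₀ K a) = E z₀ := by
  obtain ⟨a, ha, ha'⟩ := exists_forall_mem_pow_notMem_pow_succ E z₀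
  have ha0 : a ≠ 0 := by
    rintro rfl
    exact ha' (Ideal.zero_mem _)
  have hle (z) : (E z : ℤ) ≤ ordAt z (algebraMap A₀ K a) :=
    (natCast_le_ordAt_iff z ha0 _).2 (ha z)
  refine ⟨a, ha0, hle, le_antisymm ?_ (hle z₀)⟩
  rw [← natCast_le_ordAt_iff (K := K) z₀ ha0] at ha'
  push_cast at ha'
  omega

/-- `O(D)` is globally generated: a denominator `d` clears the poles of `D`, and then `D` is
corrected by the effective divisor `div d - D`. -/
theorem exists_mem_globalSections_ordAt_eq (D : HeightOneSpectrum A₀ →₀ ℤ)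
    (z₀ : HeightOneSpectrum A₀) :
    ∃ f ∈ globalSections K D, f ≠ 0 ∧ ordAt z₀ f = -D z₀ := by
  obtain ⟨d, hd0, hd, -⟩ := exists_ordAt_algebraMap_eq (K := K)
    (D.mapRange Int.toNat Int.toNat_zero) z₀
  have hdD : ∀ z, D z ≤ ordAt z (algebraMap A₀ K d) := fun z =>
    (Int.self_le_toNat (D z)).trans (by simpa using hd z)
  have hdK : algebraMap A₀ K d ≠ 0 := by simpa using hd0
  let E : HeightOneSpectrum A₀ →₀ ℕ := Finsupp.ofSupportFinite
    (fun z => (ordAt z (algebraMap A₀ K d) - D z).toNat)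
    (((finite_ordAt_algebraMap_ne_zero (K := K) hd0).union D.hasFiniteSupport).subset fun z hz => by
      by_contra h
      simp only [Set.mem_union, Set.mem_ofPred_eq, not_or, not_not, Function.mem_support] at h
      exact hz (by simp [h.1, h.2]))
  have hE : ∀ z, (E z : ℤ) = ordAt z (algebraMap A₀ K d) - D z := fun z =>
    Int.toNat_of_nonneg (sub_nonneg.2 (hdD z))
  obtain ⟨a, ha0, ha, haz⟩ := exists_ordAt_algebraMap_eq (K := K) E z₀
  have haK : algebraMap A₀ K a ≠ 0 := by simpa using ha0
  refine ⟨algebraMap A₀ K a / algebraMap A₀ K d, fun _ z => ?_, div_ne_zero haK hdK, ?_⟩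
  · rw [ordAt_div z haK hdK]
    linarith [ha z, hE z]
  · rw [ordAt_div z₀ haK hdK, haz, hE]
    ring

theorem exists_mem_globalSections_ne_zero (D : HeightOneSpectrum A₀ →₀ ℤ) :
    ∃ f ∈ globalSections K D, f ≠ 0 := by
  rcases isEmpty_or_nonempty (HeightOneSpectrum A₀) with h | ⟨⟨z⟩⟩
  · exact ⟨1, fun _ z => (h.false z).elim, one_ne_zero⟩
  · obtain ⟨f, hf, hf0, -⟩ := exists_mem_globalSections_ordAt_eq (K := K) D z
    exact ⟨f, hf, hf0⟩

theorem le_of_globalSections_le {D D' : HeightOneSpectrum A₀ →₀ ℤ}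
    (h : globalSections K D ≤ globalSections K D') (z : HeightOneSpectrum A₀) : D z ≤ D' z := by
  obtain ⟨f, hf, hf0, hfz⟩ := exists_mem_globalSections_ordAt_eq (K := K) D z
  linarith [h hf hf0 z]

theorem globalSections_fg (D : HeightOneSpectrum A₀ →₀ ℤ) : (globalSections K D).FG := by
  obtain ⟨g, hg, hg0⟩ := exists_mem_globalSections_ne_zero (K := K) D
  choose f hf hf0 hfz using exists_mem_globalSections_ordAt_eq (K := K) D
  let F : Set (HeightOneSpectrum A₀) := {z | ordAt z g ≠ 0} ∪ Function.support D
  have hF : F.Finite := (finite_ordAt_ne_zero hg0).union D.hasFiniteSupport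
  have hs : (insert g (f '' F)).Finite := (hF.image f).insert g
  refine Submodule.fg_def.2 ⟨_, hs, le_antisymm (Submodule.span_le.2 ?_) fun x hx => ?_⟩
  · rintro _ (rfl | ⟨z, -, rfl⟩)
    · exact hg
    · exact hf z
  · by_cases hx0 : x = 0
    · rw [hx0]
      exact Submodule.zero_mem _
    · refine mem_span_of_forall_exists_ordAt_le ⟨g, Set.mem_insert _ _, hg0⟩ hx0 fun z => ?_
      by_cases hz : z ∈ F
      · refine ⟨f z, Set.mem_insert_of_mem _ ⟨z, hz, rfl⟩, hf0 z, ?_⟩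
        linarith [hfz z, hx hx0 z]
      · simp only [F, Set.mem_union, Set.mem_ofPred_eq, not_or, not_not,
          Function.mem_support] at hz
        refine ⟨g, Set.mem_insert _ _, hg0, ?_⟩
        linarith [hx hx0 z]

theorem globalSections_add_le (D D' : HeightOneSpectrum A₀ →₀ ℤ) :
    globalSections K (D + D') ≤ globalSections K D * globalSections K D' := by
  intro x hx
  by_cases hx0 : x = 0
  · rw [hx0]
    exact Submodule.zero_mem _
  obtain ⟨f, hf, hf0⟩ := exists_mem_globalSections_ne_zero (K := K) D
  obtain ⟨g, hg, hg0⟩ := exists_mem_globalSections_ne_zero (K := K) D'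
  rw [← Submodule.span_eq (globalSections K D * globalSections K D')]
  refine mem_span_of_forall_exists_ordAt_le
    ⟨f * g, Submodule.mul_mem_mul hf hg, mul_ne_zero hf0 hg0⟩ hx0 fun z => ?_
  obtain ⟨f, hf, hf0, hfz⟩ := exists_mem_globalSections_ordAt_eq (K := K) D z
  obtain ⟨g, hg, hg0, hgz⟩ := exists_mem_globalSections_ordAt_eq (K := K) D' z
  refine ⟨f * g, Submodule.mul_mem_mul hf hg, mul_ne_zero hf0 hg0, ?_⟩
  have := hx hx0 z
  rw [Finsupp.add_apply] at this
  rw [ordAt_mul z hf0 hg0]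
  linarith

theorem mem_range_algebraMap_of_ordAt_nonneg {f : K}
    (h : f ≠ 0 → ∀ z : HeightOneSpectrum A₀, 0 ≤ ordAt z f) : f ∈ (algebraMap A₀ K).range := by
  by_cases hf : f = 0
  · rw [hf]
    exact Subring.zero_mem _
  · exact HeightOneSpectrum.mem_integers_of_valuation_le_one K f fun z =>
      (ordAt_nonneg_iff z hf).1 (h hf z)

end DedekindOrder

section GroupAlgebra

open AddMonoidAlgebra

instance instIsDomainAddMonoidAlgebraOfFree {K G : Type*} [Field K] [AddCommGroup G]
    [Module.Free ℤ G] [Module.Finite ℤ G] : IsDomain (AddMonoidAlgebra K G) := by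
  let e := (Module.finBasis ℤ G).equivFun
  have : UniqueSums G := UniqueSums.of_injective_addHom ⟨e, map_add e⟩ e.injective inferInstance
  exact NoZeroDivisors.to_isDomain _

theorem isLocalization_mrange_of {R S G : Type*} [CommRing R] [AddCommMonoid S] [AddCommGroup G]
    {φ : S →+ G} (hφ : Function.Injective φ) (hdiff : ∀ g, ∃ p q, g + φ q = φ p) :
    letI := (mapDomainRingHom R φ).toAlgebra
    IsLocalization (MonoidHom.mrange (of R S)) (AddMonoidAlgebra R G) := by
  let _ := (mapDomainRingHom R φ).toAlgebra
  have map_single : ∀ (s : S) (c : R),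
      algebraMap (AddMonoidAlgebra R S) (AddMonoidAlgebra R G) (single s c) = single (φ s) c :=
    fun _ _ => mapDomain_single
  refine (isLocalization_iff _ _).2 ⟨?map_units, ?surj, ?exists_of_eq⟩
  case map_units =>
    rintro ⟨_, s, rfl⟩
    refine IsUnit.of_mul_eq_one (single (-φ s.toAdd) (1 : R)) ?_
    change algebraMap (AddMonoidAlgebra R S) _ (single s.toAdd 1) * _ = 1
    rw [map_single, single_mul_single, add_neg_cancel, mul_one, one_def]
  case surj =>
    intro a
    induction a using AddMonoidAlgebra.induction_linear with
    | zero => exact ⟨(0, 1), by simp⟩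
    | add x y hx hy =>
      obtain ⟨⟨p, s⟩, hp⟩ := hx
      obtain ⟨⟨q, t⟩, hq⟩ := hy
      refine ⟨(p * t + q * s, s * t), ?_⟩
      simp only [Submonoid.coe_mul, map_mul, map_add] at hp hq ⊢
      rw [← hp, ← hq]
      ring
    | single g c =>
      obtain ⟨p, q, hpq⟩ := hdiff g
      refine ⟨(single p c, ⟨_, Multiplicative.ofAdd q, rfl⟩), ?_⟩
      change _ * algebraMap (AddMonoidAlgebra R S) _ (single q 1) = algebraMap _ _ (single p c)
      rw [map_single, map_single, single_mul_single, mul_one, hpq]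
  case exists_of_eq =>
    exact fun h => ⟨1, by rw [mapDomain_injective hφ h]⟩

/-- The inclusion into a lattice of the free commutative monoid on one of its bases. -/
noncomputable def natSpan {ι G : Type*} [AddCommGroup G] (b : Module.Basis ι ℤ G) :
    (ι →₀ ℕ) →+ G :=
  b.repr.symm.toAddEquiv.toAddMonoidHom.comp
    (Finsupp.mapRange.addMonoidHom (Nat.castAddMonoidHom ℤ))

theorem repr_natSpan_apply {ι G : Type*} [AddCommGroup G] (b : Module.Basis ι ℤ G) (s : ι →₀ ℕ)
    (i : ι) : b.repr (natSpan b s) i = s i :=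
  DFunLike.congr_fun (b.repr.apply_symm_apply _) i

theorem natSpan_injective {ι G : Type*} [AddCommGroup G] (b : Module.Basis ι ℤ G) :
    Function.Injective (natSpan b) := by
  intro s t h
  ext i
  simpa only [repr_natSpan_apply, Nat.cast_inj] using congrArg (fun g => b.repr g i) h

theorem exists_add_natSpan_eq_natSpan {ι G : Type*} [AddCommGroup G] (b : Module.Basis ι ℤ G)
    (g : G) : ∃ p q, g + natSpan b q = natSpan b p := by
  refine ⟨(b.repr g).mapRange Int.toNat rfl, (b.repr (-g)).mapRange Int.toNat rfl,
    b.repr.injective (Finsupp.ext fun i => ?_)⟩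
  simp only [map_add, map_neg, Finsupp.add_apply, repr_natSpan_apply, Finsupp.mapRange_apply,
    Finsupp.neg_apply]
  omega

theorem isIntegrallyClosed_addMonoidAlgebra_of_free {K G : Type*} [Field K] [AddCommGroup G]
    [Module.Free ℤ G] [Module.Finite ℤ G] : IsIntegrallyClosed (AddMonoidAlgebra K G) := by
  let b := Module.finBasis ℤ G
  let R := MvPolynomial (Fin (Module.finrank ℤ G)) K
  let _ : Algebra R (AddMonoidAlgebra K G) := (mapDomainRingHom K (natSpan b)).toAlgebra
  let monomials : Submonoid R := MonoidHom.mrange (of K (Fin (Module.finrank ℤ G) →₀ ℕ))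
  have monomials_le : monomials ≤ nonZeroDivisors R := by
    rintro _ ⟨s, rfl⟩
    rw [mem_nonZeroDivisors_iff_ne_zero]
    exact single_ne_zero.2 one_ne_zero
  have : IsLocalization monomials (AddMonoidAlgebra K G) :=
    isLocalization_mrange_of (natSpan_injective b) (exists_add_natSpan_eq_natSpan b)
  have : IsIntegrallyClosed R := UniqueFactorizationMonoid.instIsIntegrallyClosed
  exact isIntegrallyClosed_of_isLocalization _ monomials monomials_le

section LeadingTerm

variable {R G Γ : Type*} [AddCommGroup Γ] [LinearOrder Γ] [IsOrderedAddMonoid Γ]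

theorem coeff_mul_of_forall_le [Semiring R] [AddMonoid G] {D : G →+ Γ}
    (hD : Function.Injective D) {x y : AddMonoidAlgebra R G} {l k : G}
    (hx : ∀ i ∈ x.coeff.support, D i ≤ D l) (hy : ∀ i ∈ y.coeff.support, D i ≤ D k) :
    (∀ i ∈ (x * y).coeff.support, D i ≤ D (l + k)) ∧
      (x * y).coeff (l + k) = x.coeff l * y.coeff k := by
  classical
  constructor
  · intro i hi
    obtain ⟨p, hp, q, hq, rfl⟩ := Finset.mem_add.1 (support_coeff_mul_subset x y hi)
    rw [map_add, map_add]
    exact add_le_add (hx p hp) (hy q hq)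
  · refine coeff_mul_add_of_uniqueAdd fun p q hp hq h => ?_
    have hsum : D p + D q = D l + D k := by rw [← map_add, h, map_add]
    obtain ⟨hpl, hqk⟩ := (add_eq_add_iff_eq_and_eq (hx p hp) (hy q hq)).1 hsum
    exact ⟨hD hpl, hD hqk⟩

theorem coeff_mul_pow_of_forall_le [Semiring R] [AddMonoid G] {D : G →+ Γ}
    (hD : Function.Injective D) {x y : AddMonoidAlgebra R G} {l k : G}
    (hx : ∀ i ∈ x.coeff.support, D i ≤ D l) (hy : ∀ i ∈ y.coeff.support, D i ≤ D k) (n : ℕ) :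
    (∀ i ∈ (x * y ^ n).coeff.support, D i ≤ D (l + n • k)) ∧
      (x * y ^ n).coeff (l + n • k) = x.coeff l * y.coeff k ^ n := by
  induction n with
  | zero => simpa using hx
  | succ n ih =>
    have := coeff_mul_of_forall_le hD ih.1 hy
    rw [ih.2] at this
    rwa [pow_succ, ← mul_assoc, succ_nsmul, ← add_assoc, pow_succ, ← mul_assoc]

/-- The leading coefficients of `d * a ^ n` show that the leading term of `a` lies in `B`;
subtracting it leaves an element of smaller support with the same property. -/
theorem mem_of_forall_mul_pow_mem_of_injective [CommRing R] [AddCommMonoid G] {D : G →+ Γ}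
    (hD : Function.Injective D) {B : Subring (AddMonoidAlgebra R G)}
    (hB : ∀ a ∈ B, ∀ m, single m (a.coeff m) ∈ B)
    (hclosed : ∀ (l m : G) (g f : R), g ≠ 0 →
      (∀ n : ℕ, single (l + n • m) (g * f ^ n) ∈ B) → single m f ∈ B)
    {d : AddMonoidAlgebra R G} (hd : d ≠ 0) (a : AddMonoidAlgebra R G)
    (ha : ∀ n : ℕ, d * a ^ n ∈ B) : a ∈ B := by
  classical
  have exists_leading : ∀ x : AddMonoidAlgebra R G, x ≠ 0 →
      ∃ l ∈ x.coeff.support, ∀ i ∈ x.coeff.support, D i ≤ D l := fun x hx =>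
    Finset.exists_max_image _ D (Finsupp.support_nonempty_iff.2 (by simpa using hx))
  obtain ⟨l, hl, hlmax⟩ := exists_leading d hd
  induction hc : a.coeff.support.card using Nat.strong_induction_on generalizing a with
  | _ c ih =>
    by_cases ha0 : a = 0
    · exact ha0 ▸ B.zero_mem
    obtain ⟨m, hm, hmmax⟩ := exists_leading a ha0
    have leading_mem : single m (a.coeff m) ∈ B := by
      refine hclosed l m (d.coeff l) _ (Finsupp.mem_support_iff.1 hl) fun n => ?_
      rw [← (coeff_mul_pow_of_forall_le hD hlmax hmmax n).2]
      exact hB _ (ha n) _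
    have erase_mem : a.erase m ∈ B := by
      refine ih _ ?_ (a.erase m) (fun n => ?_) rfl
      · rw [← hc, coeff_erase, Finsupp.support_erase]
        exact Finset.card_erase_lt_of_mem hm
      · have herase : a.erase m = a + -single m (a.coeff m) := by
          rw [eq_add_neg_iff_add_eq, erase_add_single]
        rw [herase, add_pow, Finset.mul_sum]
        refine B.sum_mem fun i _ => ?_
        rw [← mul_assoc, ← mul_assoc]
        exact B.mul_mem (B.mul_mem (ha i) (B.pow_mem (B.neg_mem leading_mem) _))
          (natCast_mem B _)
    rw [← single_add_erase m a]
    exact B.add_mem leading_mem erase_mem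

end LeadingTerm

theorem mem_of_forall_mul_pow_mem {R G : Type*} [CommRing R] [AddCommGroup G] [Module.Free ℤ G]
    [Module.Finite ℤ G] {B : Subring (AddMonoidAlgebra R G)}
    (hB : ∀ a ∈ B, ∀ m, single m (a.coeff m) ∈ B)
    (hclosed : ∀ (l m : G) (g f : R), g ≠ 0 →
      (∀ n : ℕ, single (l + n • m) (g * f ^ n) ∈ B) → single m f ∈ B)
    {d : AddMonoidAlgebra R G} (hd : d ≠ 0) (a : AddMonoidAlgebra R G)
    (ha : ∀ n : ℕ, d * a ^ n ∈ B) : a ∈ B := by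
  let D : G →+ Lex (Fin (Module.finrank ℤ G) → ℤ) :=
    { toFun := fun g => toLex ((Module.finBasis ℤ G).equivFun g)
      map_zero' := by rw [map_zero, toLex_zero]
      map_add' := fun x y => by rw [map_add, toLex_add] }
  have hD : Function.Injective D := toLex.injective.comp (Module.finBasis ℤ G).equivFun.injective
  exact mem_of_forall_mul_pow_mem_of_injective hD hB hclosed hd a ha

end GroupAlgebra

section GradedSubalgebra

open AddMonoidAlgebra

variable {A₀ : Type*} [CommRing A₀] {K : Type*} [Field K] [Algebra A₀ K]
  {N : Type*} [AddCommGroup N]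

theorem mem_gradedPiece {A : Subalgebra A₀ (AddMonoidAlgebra K (DualLattice N))}
    {m : DualLattice N} {f : K} : f ∈ gradedPiece A m ↔ single m f ∈ A := Iff.rfl

theorem mem_of_forall_single_mem {G : Type*} [AddMonoid G]
    {A : Subalgebra A₀ (AddMonoidAlgebra K G)} {a : AddMonoidAlgebra K G}
    (h : ∀ m, single m (a.coeff m) ∈ A) : a ∈ A := by
  rw [← sum_coeff_single a]
  exact A.sum_mem fun m _ => h m

theorem gradedPiece_ne_bot_iff {A : Subalgebra A₀ (AddMonoidAlgebra K (DualLattice N))}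
    {m : DualLattice N} : gradedPiece A m ≠ ⊥ ↔ ∃ f ≠ 0, single m f ∈ A := by
  rw [Submodule.ne_bot_iff]
  exact exists_congr fun f => and_comm

theorem mem_of_hasFullFractionField {A : Subalgebra A₀ (AddMonoidAlgebra K (DualLattice N))}
    (h : HasFullFractionField A) (H : AddSubgroup (DualLattice N))
    (hH : ∀ a ∈ A, ∀ m, a.coeff m ≠ 0 → m ∈ H) (m : DualLattice N) : m ∈ H := by
  let L := FractionRing (AddMonoidAlgebra K (DualLattice N))
  have : IsFractionRing A L := h
  obtain ⟨⟨p, q⟩, hpq⟩ := IsLocalization.surj (nonZeroDivisors A)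
    (algebraMap (AddMonoidAlgebra K (DualLattice N)) L (single m 1))
  have single_mul : single m 1 * ((q : A) : AddMonoidAlgebra K (DualLattice N)) =
      (p : AddMonoidAlgebra K (DualLattice N)) := by
    apply IsFractionRing.injective (AddMonoidAlgebra K (DualLattice N)) L
    rw [map_mul]
    exact hpq
  obtain ⟨k, hk⟩ : ∃ k, ((q : A) : AddMonoidAlgebra K (DualLattice N)).coeff k ≠ 0 := by
    by_contra! hzero
    have hq0 : ((q : A) : AddMonoidAlgebra K (DualLattice N)) ≠ 0 := by simp
    exact hq0 (by ext k; simpa using hzero k)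
  have hmk : (p : AddMonoidAlgebra K (DualLattice N)).coeff (m + k) ≠ 0 := by
    rwa [← single_mul, coeff_single_mul_eq_mul_coeff k (fun _ _ => add_right_inj m), one_mul]
  simpa only [add_sub_cancel_right] using H.sub_mem (hH _ p.2 _ hmk) (hH _ (q : A).2 _ hk)

theorem isFractionRing_of_subfieldClosure_eq_top {R L : Type*} [CommRing R] [Field L]
    [Algebra R L] [FaithfulSMul R L] (h : Subfield.closure (Set.range (algebraMap R L)) = ⊤) :
    IsFractionRing R L := by
  refine IsFractionRing.of_field R L fun x => ?_
  have closure_le : Subring.closure (Set.range (algebraMap R L)) ≤ (algebraMap R L).range :=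
    Subring.closure_le.2 fun _ hx => hx
  obtain ⟨y, hy, z, hz, rfl⟩ := Subfield.mem_closure_iff.1 (h ▸ Subfield.mem_top x)
  obtain ⟨y, rfl⟩ := closure_le hy
  obtain ⟨z, rfl⟩ := closure_le hz
  exact ⟨y, z, rfl⟩

theorem map_mem_subfield_of_closure_eq_top {G L : Type*} [AddCommGroup G] [Field L]
    (φ : AddMonoidAlgebra K G →+* L) (F : Subfield L) (hK : ∀ c, φ (single 0 c) ∈ F) {S : Set G}
    (hS : ∀ m ∈ S, φ (single m 1) ∈ F) (h : AddSubgroup.closure S = ⊤)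
    (a : AddMonoidAlgebra K G) : φ a ∈ F := by
  have monomial_mem (m : G) : φ (single m 1) ∈ F := by
    induction (h ▸ AddSubgroup.mem_top m : m ∈ AddSubgroup.closure S) using
      AddSubgroup.closure_induction with
    | mem m hm => exact hS m hm
    | zero => exact hK 1
    | add m m' _ _ hm hm' =>
      have := F.mul_mem hm hm'
      rwa [← map_mul, single_mul_single, mul_one] at this
    | neg m _ hm =>
      have hinv : φ (single (-m) 1) * φ (single m 1) = 1 := by
        rw [← map_mul, single_mul_single, neg_add_cancel, mul_one, ← one_def, map_one]
      rw [eq_inv_of_mul_eq_one_left hinv]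
      exact F.inv_mem hm
  induction a using AddMonoidAlgebra.induction_linear with
  | zero => rw [map_zero]; exact F.zero_mem
  | add x y hx hy => rw [map_add]; exact F.add_mem hx hy
  | single m c =>
    have := F.mul_mem (hK c) (monomial_mem m)
    rwa [← map_mul, single_mul_single, zero_add, mul_one] at this

variable [Module.Free ℤ N] [Module.Finite ℤ N]

theorem hasFullFractionField_of_closure_eq_top [IsFractionRing A₀ K]
    (A : Subalgebra A₀ (AddMonoidAlgebra K (DualLattice N)))
    (h : AddSubgroup.closure {m | gradedPiece A m ≠ ⊥} = ⊤) : HasFullFractionField A := by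
  let L := FractionRing (AddMonoidAlgebra K (DualLattice N))
  let φ : AddMonoidAlgebra K (DualLattice N) →+* L := algebraMap _ _
  have hφ : Function.Injective φ := IsFractionRing.injective _ _
  have : FaithfulSMul A L := by
    rw [faithfulSMul_iff_algebraMap_injective]
    exact hφ.comp Subtype.val_injective
  let F : Subfield L := Subfield.closure (Set.range (algebraMap A L))
  have mem_F {a} (ha : a ∈ A) : φ a ∈ F := Subfield.subset_closure ⟨⟨a, ha⟩, rfl⟩
  have scalar_mem (c : K) : φ (single 0 c) ∈ F := by
    have : Subfield.closure (Set.range (algebraMap A₀ K)) ≤ F.comap (φ.comp singleZeroRingHom) :=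
      Subfield.closure_le.2 <| Set.range_subset_iff.2 fun a => mem_F (A.algebraMap_mem a)
    rw [IsFractionRing.closure_range_algebraMap] at this
    exact this (Subfield.mem_top c)
  have monomial_mem : ∀ m ∈ {m | gradedPiece A m ≠ ⊥}, φ (single m 1) ∈ F := fun m hm => by
    obtain ⟨f, hf0, hf⟩ := gradedPiece_ne_bot_iff.1 hm
    have := F.mul_mem (mem_F hf) (scalar_mem f⁻¹)
    rwa [← map_mul, single_mul_single, add_zero, mul_inv_cancel₀ hf0] at this
  have range_le : Set.range φ ⊆ F := Set.range_subset_iff.2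
    (map_mem_subfield_of_closure_eq_top φ F scalar_mem monomial_mem h)
  refine isFractionRing_of_subfieldClosure_eq_top (top_le_iff.1 ?_)
  rw [← IsFractionRing.closure_range_algebraMap (AddMonoidAlgebra K (DualLattice N)) L]
  exact Subfield.closure_le.2 range_le

theorem isIntegrallyClosed_of_homogeneous
    {A : Subalgebra A₀ (AddMonoidAlgebra K (DualLattice N))}
    (hA : IsGradedSubalgebra A) (hfull : HasFullFractionField A)
    (hclosed : ∀ (l m : DualLattice N) (g f : K), g ≠ 0 →
      (∀ n : ℕ, single (l + n • m) (g * f ^ n) ∈ A) → single m f ∈ A) :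
    IsIntegrallyClosed A := by
  let L := FractionRing (AddMonoidAlgebra K (DualLattice N))
  have : IsFractionRing A L := hfull
  have : IsIntegrallyClosed (AddMonoidAlgebra K (DualLattice N)) :=
    isIntegrallyClosed_addMonoidAlgebra_of_free
  refine (isIntegrallyClosed_iff L).2 fun {x} hx => ?_
  obtain ⟨a, rfl⟩ := (isIntegrallyClosed_iff L).1 this
    (hx.tower_top : IsIntegral (AddMonoidAlgebra K (DualLattice N)) x)
  obtain ⟨d, hd, hda⟩ := hx.isAlmostIntegral
  have hd0 : (d : AddMonoidAlgebra K (DualLattice N)) ≠ 0 := by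
    simpa using nonZeroDivisors.ne_zero hd
  have mul_pow_mem (n : ℕ) : d * a ^ n ∈ A := by
    obtain ⟨y, hy⟩ := hda n
    have : (y : AddMonoidAlgebra K (DualLattice N)) = d * a ^ n := by
      apply IsFractionRing.injective (AddMonoidAlgebra K (DualLattice N)) L
      rw [map_mul, map_pow]
      exact hy.trans (Algebra.smul_def d _)
    exact this ▸ y.2
  have ha : a ∈ A.toSubring :=
    mem_of_forall_mul_pow_mem (B := A.toSubring) hA hclosed hd0 a mul_pow_mem
  exact ⟨⟨a, ha⟩, rfl⟩

end GradedSubalgebra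

section FiniteGeneration

open AddMonoidAlgebra

/-- Hilbert's basis theorem, applied to the ideal generated by the monomials `a i * X ^ s i`. -/
theorem exists_finset_forall_mem_span_image {R σ I : Type*} [CommRing R] [IsNoetherianRing R]
    [Finite σ] (a : I → R) (s : I → σ →₀ ℕ) :
    ∃ S : Finset I, ∀ i, a i ∈ Ideal.span (a '' {j | j ∈ S ∧ s j ≤ s i}) := by
  classical
  let e : I → MvPolynomial σ R := fun i => MvPolynomial.monomial (s i) (a i)
  have hfg : (Ideal.span (Set.range e)).FG := IsNoetherian.noetherian _
  obtain ⟨T, hT, hspan⟩ := (Submodule.fg_span_iff_fg_span_finset_subset _).1 hfg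
  obtain ⟨S, rfl⟩ : ∃ S : Finset I, S.image e = T := by
    rw [← Set.image_univ] at hT
    obtain ⟨S, -, hS⟩ := Finset.subset_set_image_iff.1 hT
    exact ⟨S, hS⟩
  refine ⟨S, fun i => ?_⟩
  have hmem : e i ∈ Submodule.span (MvPolynomial σ R) (e '' (S : Set I)) := by
    rw [← Finset.coe_image, ← hspan]
    exact Submodule.subset_span ⟨i, rfl⟩
  obtain ⟨c, hc⟩ := (Submodule.mem_span_image_finset_iff_exists_fun _).1 hmem
  have hcoeff := congrArg (MvPolynomial.coeff (s i)) hc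
  simp only [e, MvPolynomial.coeff_sum, smul_eq_mul, MvPolynomial.coeff_mul_monomial',
    MvPolynomial.coeff_monomial, if_true] at hcoeff
  rw [← hcoeff]
  refine Ideal.sum_mem _ fun j _ => ?_
  split_ifs with hle
  · exact Ideal.mul_mem_left _ _ (Ideal.subset_span ⟨j, ⟨j.2, hle⟩, rfl⟩)
  · exact Ideal.zero_mem _

section SignedExponent

variable {ι G : Type*} [AddCommGroup G] (b : Module.Basis ι ℤ G)

/-- The positive and negative parts of the coordinates of an element of a lattice, a vector of
natural numbers. It serves to compare exponents coordinatewise without changes of sign. -/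
noncomputable def signedExponent (m : G) : ι ⊕ ι →₀ ℕ :=
  Finsupp.sumElim ((b.repr m).mapRange Int.toNat rfl) ((b.repr (-m)).mapRange Int.toNat rfl)

theorem signedExponent_inl (m : G) (i : ι) :
    signedExponent b m (Sum.inl i) = (b.repr m i).toNat := rfl

theorem signedExponent_inr (m : G) (i : ι) :
    signedExponent b m (Sum.inr i) = (-b.repr m i).toNat := by
  rw [signedExponent, Finsupp.sumElim_inr, Finsupp.mapRange_apply, map_neg, Finsupp.neg_apply]

theorem signedExponent_sub_add {m m' : G} (h : signedExponent b m' ≤ signedExponent b m) :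
    signedExponent b (m - m') + signedExponent b m' = signedExponent b m := by
  ext i
  obtain i | i := i
  all_goals
    have hpos := h (Sum.inl i)
    have hneg := h (Sum.inr i)
    simp only [signedExponent_inl, signedExponent_inr, Finsupp.add_apply, map_sub,
      Finsupp.sub_apply] at hpos hneg ⊢
    omega

theorem signedExponent_ne_zero {m : G} (hm : m ≠ 0) : signedExponent b m ≠ 0 := by
  contrapose! hm
  refine b.ext_elem fun i => ?_
  have hpos := DFunLike.congr_fun hm (Sum.inl i)
  have hneg := DFunLike.congr_fun hm (Sum.inr i)
  simp only [signedExponent_inl, signedExponent_inr, Finsupp.zero_apply, map_zero] at hpos hneg ⊢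
  omega

theorem signedExponent_sub_lt {m m' : G} (hm' : m' ≠ 0)
    (h : signedExponent b m' ≤ signedExponent b m) :
    signedExponent b (m - m') < signedExponent b m := by
  rw [← signedExponent_sub_add b h]
  exact lt_add_of_pos_right _ (pos_iff_ne_zero.2 (signedExponent_ne_zero b hm'))

end SignedExponent

variable {A₀ : Type*} [CommRing A₀] {K : Type*} [Field K] [Algebra A₀ K]
  {N : Type*} [AddCommGroup N]

theorem single_coeff_mem_of_mem_span {G : Type*} [AddCommGroup G]
    {A B : Subalgebra A₀ (AddMonoidAlgebra K G)} {m : G} {S : Set A}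
    (hS : ∀ x ∈ S, ∃ (k : G) (g : K), (x : AddMonoidAlgebra K G) = single k g ∧ single k g ∈ B ∧
      ∀ a ∈ A, single (m - k) (a.coeff (m - k)) ∈ B)
    {x : A} (hx : x ∈ Ideal.span S) : single m ((x : AddMonoidAlgebra K G).coeff m) ∈ B := by
  induction hx using Submodule.closure_induction with
  | zero => simp
  | add x y _ _ hx hy => simpa [single_add] using B.add_mem hx hy
  | smul_mem a x hx =>
    obtain ⟨k, g, hxg, hg, ha⟩ := hS x hx
    have := B.mul_mem (ha a a.2) hg
    rwa [single_mul_single, sub_add_cancel, ← coeff_mul_single_eq_coeff_mul (m - k)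
      fun _ _ => eq_sub_iff_add_eq.symm, ← hxg] at this

/-- The degree-`m` component of an expression of `f χ^m` by generators of smaller signed exponent
has coefficients of smaller signed exponent. -/
theorem exists_adjoin_eq_of_isNoetherianRing [Module.Free ℤ N] [Module.Finite ℤ N]
    {A : Subalgebra A₀ (AddMonoidAlgebra K (DualLattice N))} (hA : IsGradedSubalgebra A)
    (h0 : gradedPiece A 0 = 1) [IsNoetherianRing A] :
    ∃ (r : ℕ) (f : Fin r → K) (m : Fin r → DualLattice N), (∀ i, f i ≠ 0) ∧
      A = Algebra.adjoin A₀ (Set.range fun i => single (m i) (f i)) := by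
  let b := Module.finBasis ℤ (DualLattice N)
  let I := {p : DualLattice N × K // p.1 ≠ 0 ∧ p.2 ≠ 0 ∧ single p.1 p.2 ∈ A}
  obtain ⟨S, hS⟩ := exists_finset_forall_mem_span_image
    (fun p : I => (⟨single p.1.1 p.1.2, p.2.2.2⟩ : A)) (fun p => signedExponent b p.1.1)
  let gen : Fin S.card → I := fun i => (S.equivFin.symm i : I)
  let B : Subalgebra A₀ (AddMonoidAlgebra K (DualLattice N)) :=
    Algebra.adjoin A₀ (Set.range fun i => single (gen i).1.1 (gen i).1.2)
  have gen_mem {p : I} (hp : p ∈ S) : single p.1.1 p.1.2 ∈ B :=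
    Algebra.subset_adjoin ⟨S.equivFin ⟨p, hp⟩, by simp [gen]⟩
  have single_mem (m : DualLattice N) (f : K) (hf : single m f ∈ A) : single m f ∈ B := by
    induction hm : signedExponent b m using WellFoundedLT.induction generalizing m f with
    | ind _ ih =>
      subst hm
      by_cases hm0 : m = 0
      · subst hm0
        rw [← mem_gradedPiece, h0, Submodule.mem_one] at hf
        obtain ⟨c, rfl⟩ := hf
        exact B.algebraMap_mem c
      by_cases hf0 : f = 0
      · rw [hf0, single_zero]
        exact B.zero_mem
      have := single_coeff_mem_of_mem_span (m := m) (B := B) ?_ (hS ⟨(m, f), hm0, hf0, hf⟩)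
      · simpa using this
      · rintro _ ⟨p, ⟨hpS, hpm⟩, rfl⟩
        exact ⟨p.1.1, p.1.2, rfl, gen_mem hpS, fun a ha =>
          ih _ (signedExponent_sub_lt b p.2.1 hpm) _ _ (hA a ha _) rfl⟩
  refine ⟨S.card, fun i => (gen i).1.2, fun i => (gen i).1.1, fun i => (gen i).2.2.1,
    le_antisymm (fun a ha => ?_) (Algebra.adjoin_le ?_)⟩
  · exact mem_of_forall_single_mem fun m => single_mem m _ (hA a ha m)
  · exact Set.range_subset_iff.2 fun i => (gen i).2.2.2

end FiniteGeneration

/-! ### The algebra of a polyhedral divisor -/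

section DualCone

theorem forall_mem_convexHull_add_le_iff {𝕜 V : Type*} [Field 𝕜] [LinearOrder 𝕜]
    [IsStrictOrderedRing 𝕜] [AddCommGroup V] [Module 𝕜 V] {Q : Set V} {σ : PointedCone 𝕜 V}
    {u : Module.Dual 𝕜 V} (hu : ∀ s ∈ σ, 0 ≤ u s) {c : 𝕜} :
    (∀ v ∈ convexHull 𝕜 Q + (σ : Set V), c ≤ u v) ↔ ∀ q ∈ Q, c ≤ u q := by
  refine ⟨fun h q hq => h q ⟨q, subset_convexHull 𝕜 Q hq, 0, σ.zero_mem, add_zero q⟩, fun h => ?_⟩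
  rintro _ ⟨x, hx, s, hs, rfl⟩
  have hxu : c ≤ u x := convexHull_min h (convex_halfSpace_ge u.isLinear c) hx
  rw [map_add]
  exact le_add_of_le_of_nonneg hxu (hu s hs)

variable {N : Type*} [AddCommGroup N] {σ : PointedCone ℚ (RatSpace N)}

theorem mem_dualCone_hull {T : Set (RatSpace N)} {u : DualRatSpace N} :
    u ∈ dualCone (PointedCone.hull ℚ T) ↔ ∀ s ∈ T, 0 ≤ u s := by
  rw [dualCone, PointedCone.dual_hull]
  rfl

theorem fg_of_forall_mem_iff_le_toDualRat {G ι : Type*} [AddCommGroup G] [AddGroup.FG G]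
    [Finite ι] (π : G →+ DualLattice N) (ψ : ι → G →+ ℤ) (v : ι → RatSpace N)
    {S : AddSubmonoid G} (hS : ∀ x, x ∈ S ↔ ∀ i, (ψ i x : ℚ) ≤ toDualRat (π x) (v i)) :
    S.FG := by
  choose k hk l hl using fun i => exists_pos_forall_eq_mul_toDualRat (v i)
  refine fg_of_forall_mem_iff_nonneg (fun i => (l i).comp π - k i • ψ i) fun x =>
    (hS x).trans (forall_congr' fun i => ?_)
  have hki : (0 : ℚ) < k i := by exact_mod_cast hk i
  rw [AddMonoidHom.sub_apply, AddMonoidHom.comp_apply, AddMonoidHom.nsmul_apply, nsmul_eq_mul,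
    sub_nonneg, ← Int.cast_le (R := ℚ), hl, Int.cast_mul, Int.cast_natCast,
    mul_le_mul_iff_right₀ hki]

variable [Module.Finite ℤ N]

theorem span_dualCone_eq_top (hσ : IsPointedPolyhedralCone σ) :
    Submodule.span ℚ (dualCone σ : Set (DualRatSpace N)) = ⊤ := by
  have h : (Submodule.span ℚ (dualCone σ : Set (DualRatSpace N))).dualCoannihilator = ⊥ := by
    refine (Submodule.eq_bot_iff _).2 fun v hv => ?_
    have hv (u) (hu : u ∈ dualCone σ) : u v = 0 :=
      (Submodule.mem_dualCoannihilator v).1 hv u (Submodule.subset_span hu)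
    have hmem {w : RatSpace N} (hw : ∀ u ∈ dualCone σ, 0 ≤ u w) : w ∈ σ := by
      rw [← dual_id_dual_eval_of_fg hσ.1]
      exact hw
    by_contra hv0
    exact hσ.2 v (hmem fun u hu => (hv u hu).ge) hv0
      (hmem fun u hu => by rw [map_neg, hv u hu, neg_zero])
  rw [← Subspace.dualCoannihilator_dualAnnihilator_eq
    (W := Submodule.span ℚ (dualCone σ : Set (DualRatSpace N))), h,
    Submodule.dualAnnihilator_bot]

theorem exists_mem_dualCone_add_mem_dualCone [Module.Free ℤ N] (hσ : IsPointedPolyhedralCone σ)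
    (m : DualLattice N) :
    ∃ m' : DualLattice N, toDualRat m' ∈ dualCone σ ∧ toDualRat (m + m') ∈ dualCone σ := by
  rcases subsingleton_or_nontrivial (DualRatSpace N) with _ | _
  · have h (u : DualRatSpace N) : u ∈ dualCone σ := Subsingleton.elim 0 u ▸ (dualCone σ).zero_mem
    exact ⟨0, h _, h _⟩
  have hrep : (dualCone σ : ConvexCone ℚ (DualRatSpace N)).IsReproducing :=
    ConvexCone.IsReproducing.of_span_eq_top (span_dualCone_eq_top hσ)
  obtain ⟨a, ha, b, hb, hab⟩ : toDualRat m ∈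
      (dualCone σ : Set (DualRatSpace N)) - (dualCone σ : Set (DualRatSpace N)) :=
    hrep.sub_eq_univ.ge (Set.mem_univ _)
  obtain ⟨k, hk, m', hm'⟩ := exists_pos_smul_eq_toDualRat b
  have hsum : toDualRat (m + m') = a + ((k : ℚ) - 1) • b := by
    rw [map_add, ← hab, ← hm']
    module
  have hk : (0 : ℚ) ≤ k - 1 := by
    rw [sub_nonneg]
    exact_mod_cast hk
  refine ⟨m', hm' ▸ (dualCone σ).smul_mem (Nat.cast_nonneg k) hb, ?_⟩
  rw [hsum]
  exact (dualCone σ).add_mem ha ((dualCone σ).smul_mem hk hb)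

end DualCone

theorem nonneg_of_forall_nonneg_add_nsmul {Γ : Type*} [AddCommGroup Γ] [LinearOrder Γ]
    [IsOrderedAddMonoid Γ] [Archimedean Γ] {a b : Γ} (h : ∀ n : ℕ, 0 ≤ a + n • b) : 0 ≤ b := by
  by_contra! hb
  obtain ⟨n, hn⟩ := exists_lt_nsmul (neg_pos.2 hb) a
  rw [smul_neg, lt_neg_iff_add_neg] at hn
  exact hn.not_ge (h n)

section GlobalSections

open AddMonoidAlgebra IsDedekindDomain

variable {A₀ : Type*} [CommRing A₀] [IsDedekindDomain A₀]
  {K : Type*} [Field K] [Algebra A₀ K] [IsFractionRing A₀ K] {G : Type*} [AddMonoid G]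

theorem single_mem_of_mem_closure {F : Set (G × (HeightOneSpectrum A₀ →₀ ℤ))}
    {B : Subalgebra A₀ (AddMonoidAlgebra K G)}
    (hB : ∀ x ∈ F, ∀ f ∈ globalSections K x.2, single x.1 f ∈ B)
    {x : G × (HeightOneSpectrum A₀ →₀ ℤ)} (hx : x ∈ AddSubmonoid.closure F) {f : K}
    (hf : f ∈ globalSections K x.2) : single x.1 f ∈ B := by
  induction hx using AddSubmonoid.closure_induction generalizing f with
  | mem x hx => exact hB x hx f hf
  | zero =>
    obtain ⟨c, rfl⟩ := mem_range_algebraMap_of_ordAt_nonneg (A₀ := A₀) (f := f) fun hf0 z => by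
      simpa using hf hf0 z
    exact B.algebraMap_mem c
  | add x y _ _ hx hy =>
    have hle : globalSections K x.2 * globalSections K y.2 ≤
        B.toSubmodule.comap (lsingle (x.1 + y.1)) :=
      Submodule.mul_le.2 fun g hg h hh => by
        simpa [single_mul_single] using B.mul_mem (hx hg) (hy hh)
    exact hle (globalSections_add_le _ _ hf)

theorem fg_adjoin_iUnion_single_globalSections
    {S : AddSubmonoid (G × (HeightOneSpectrum A₀ →₀ ℤ))} (hS : S.FG) :
    (Algebra.adjoin A₀ (⋃ x ∈ S, single x.1 '' (globalSections K x.2 : Set K))).FG := by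
  classical
  obtain ⟨F, rfl⟩ := hS
  choose H hH using fun E : HeightOneSpectrum A₀ →₀ ℤ => globalSections_fg (K := K) E
  let gens : Finset (AddMonoidAlgebra K G) := F.biUnion fun x => (H x.2).image (single x.1)
  refine ⟨gens, le_antisymm (Algebra.adjoin_mono fun a ha => ?_) (Algebra.adjoin_le ?_)⟩
  · obtain ⟨x, hx, ha⟩ := Finset.mem_biUnion.1 ha
    obtain ⟨f, hf, rfl⟩ := Finset.mem_image.1 ha
    exact Set.mem_iUnion₂_of_mem (AddSubmonoid.subset_closure hx)
      ⟨f, hH x.2 ▸ Submodule.subset_span hf, rfl⟩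
  · refine Set.iUnion₂_subset fun x hx => ?_
    rintro _ ⟨f, hf, rfl⟩
    refine single_mem_of_mem_closure (fun y hy => ?_) hx hf
    have hle : globalSections K y.2 ≤
        (Algebra.adjoin A₀ (gens : Set (AddMonoidAlgebra K G))).toSubmodule.comap
          (lsingle y.1) := by
      rw [← hH y.2]
      exact Submodule.span_le.2 fun g hg => Algebra.subset_adjoin
        (Finset.mem_biUnion.2 ⟨y, hy, Finset.mem_image_of_mem _ hg⟩)
    exact fun g hg => hle hg

end GlobalSections

namespace PolyhedralDivisor

open AddMonoidAlgebra IsDedekindDomain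

variable {A₀ : Type*} [CommRing A₀] {N : Type*} [AddCommGroup N]
  {σ : PointedCone ℚ (RatSpace N)}

theorem supportValue_of_eq_nsmul (D : PolyhedralDivisor A₀ σ) (z : HeightOneSpectrum A₀)
    {u u' : DualRatSpace N} {n : ℕ} (h : u' = n • u) (hu : u ∈ dualCone σ)
    (hu' : u' ∈ dualCone σ) : D.supportValue z hu' = n * D.supportValue z hu := by
  subst h
  obtain ⟨⟨v, hv, hvu⟩, hmin⟩ := D.isLeast_supportValue z hu
  refine (D.isLeast_supportValue z hu').unique
    ⟨⟨v, hv, by rw [← hvu, LinearMap.smul_apply, nsmul_eq_mul]⟩, ?_⟩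
  rintro _ ⟨w, hw, rfl⟩
  rw [LinearMap.smul_apply, nsmul_eq_mul]
  exact mul_le_mul_of_nonneg_left (hmin ⟨w, hw, rfl⟩) (Nat.cast_nonneg n)

theorem le_supportValue_iff (D : PolyhedralDivisor A₀ σ) (z : HeightOneSpectrum A₀)
    {u : DualRatSpace N} (hu : u ∈ dualCone σ) {c : ℚ} :
    c ≤ D.supportValue z hu ↔ ∀ v ∈ D.coeff z, c ≤ u v := by
  rw [le_isGLB_iff (D.isLeast_supportValue z hu).isGLB, mem_lowerBounds, Set.forall_mem_image]

theorem nonneg_add_floor_supportValue_iff (D : PolyhedralDivisor A₀ σ) (z : HeightOneSpectrum A₀)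
    {u : DualRatSpace N} (hu : u ∈ dualCone σ) {n : ℤ} :
    0 ≤ n + ⌊D.supportValue z hu⌋ ↔ ∀ v ∈ D.coeff z, 0 ≤ n + u v := by
  rw [← neg_le_iff_add_nonneg', Int.le_floor, le_supportValue_iff, Int.cast_neg]
  simp only [neg_le_iff_add_nonneg']

theorem exists_supportValue_lt_of_notMem [Module.Free ℤ N] [Module.Finite ℤ N]
    (hσ : σ.FG) {D D' : PolyhedralDivisor A₀ σ} {z : HeightOneSpectrum A₀} {v : RatSpace N}
    (hv : v ∈ D.coeff z) (hv' : v ∉ D'.coeff z) :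
    ∃ (m : DualLattice N) (hm : toDualRat m ∈ dualCone σ),
      D.supportValue z hm < D'.supportValue z hm := by
  obtain ⟨Q, hQ, hne, hQσ⟩ := D'.isSigmaPolyhedron z
  rw [hQσ] at hv'
  obtain ⟨u, huσ, huv⟩ := exists_dual_nonneg_lt_of_notMem_convexHull_add hQ hne hσ hv'
  obtain ⟨k, hk, m, hm⟩ := exists_pos_smul_eq_toDualRat u
  have hk : (0 : ℚ) < k := by exact_mod_cast hk
  have hmσ : toDualRat m ∈ dualCone σ := hm ▸ (dualCone σ).smul_mem hk.le (mem_dualCone.2 huσ)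
  obtain ⟨q, hq, hqmin⟩ := Set.exists_min_image Q (toDualRat m) hQ hne
  refine ⟨m, hmσ, ?_⟩
  calc D.supportValue z hmσ ≤ toDualRat m v := (D.isLeast_supportValue z hmσ).2 ⟨v, hv, rfl⟩
    _ < toDualRat m q := by
      rw [← hm, LinearMap.smul_apply, LinearMap.smul_apply]
      exact mul_lt_mul_of_pos_left (huv q hq) hk
    _ ≤ D'.supportValue z hmσ := by
      rw [le_supportValue_iff, hQσ, forall_mem_convexHull_add_le_iff (mem_dualCone.1 hmσ)]
      exact hqmin

/-- The pairs `(m, E)` of a weight `m ∈ σ^∨ ∩ M` and an integral divisor `E ≤ 𝔇(m)` which vanishes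
outside the support of `𝔇`. The algebra of sections is generated by the `H⁰(Y, O_Y(E)) χ^m`. -/
def sectionMonoid (D : PolyhedralDivisor A₀ σ) :
    AddSubmonoid (DualLattice N × (HeightOneSpectrum A₀ →₀ ℤ)) where
  carrier := {x | toDualRat x.1 ∈ dualCone σ ∧ ∀ z, (D.coeff z = σ → x.2 z = 0) ∧
    ∀ v ∈ D.coeff z, (x.2 z : ℚ) ≤ toDualRat x.1 v}
  zero_mem' := by simp
  add_mem' := by
    rintro x y ⟨hx, hx'⟩ ⟨hy, hy'⟩
    refine ⟨?_, fun z => ⟨fun hz => ?_, fun v hv => ?_⟩⟩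
    · rw [Prod.fst_add, map_add]
      exact (dualCone σ).add_mem hx hy
    · rw [Prod.snd_add, Finsupp.add_apply, (hx' z).1 hz, (hy' z).1 hz, add_zero]
    · rw [Prod.fst_add, map_add, LinearMap.add_apply, Prod.snd_add, Finsupp.add_apply,
        Int.cast_add]
      exact add_le_add ((hx' z).2 v hv) ((hy' z).2 v hv)

theorem mem_sectionMonoid {D : PolyhedralDivisor A₀ σ}
    {x : DualLattice N × (HeightOneSpectrum A₀ →₀ ℤ)} : x ∈ D.sectionMonoid ↔
      toDualRat x.1 ∈ dualCone σ ∧ ∀ z, (D.coeff z = σ → x.2 z = 0) ∧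
        ∀ v ∈ D.coeff z, (x.2 z : ℚ) ≤ toDualRat x.1 v :=
  Iff.rfl

theorem mk_floorEval_mem_sectionMonoid (D : PolyhedralDivisor A₀ σ) {m : DualLattice N}
    (hm : toDualRat m ∈ dualCone σ) : (m, D.floorEval hm) ∈ D.sectionMonoid := by
  refine mem_sectionMonoid.2 ⟨hm, fun z => ⟨fun hz => ?_, (D.le_supportValue_iff z hm).1 ?_⟩⟩
  · rw [floorEval_apply, D.supportValue_eq_zero hz, Int.floor_zero]
  · exact Int.floor_le _

theorem mem_sectionMonoid_iff_of_generators (D : PolyhedralDivisor A₀ σ) {T : Set (RatSpace N)}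
    (hT : PointedCone.hull ℚ T = σ) {Q : HeightOneSpectrum A₀ → Set (RatSpace N)}
    (hQ : ∀ z, D.coeff z = convexHull ℚ (Q z) + (σ : Set (RatSpace N)))
    {x : DualLattice N × (HeightOneSpectrum A₀ →₀ ℤ)} : x ∈ D.sectionMonoid ↔
      (∀ z, D.coeff z = σ → x.2 z = 0) ∧ (∀ s ∈ T, 0 ≤ toDualRat x.1 s) ∧
        ∀ z, D.coeff z ≠ σ → ∀ q ∈ Q z, (x.2 z : ℚ) ≤ toDualRat x.1 q := by
  rw [mem_sectionMonoid, forall_and, ← mem_dualCone_hull, hT, and_left_comm]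
  refine and_congr_right fun hx0 => and_congr_right fun hx => forall_congr' fun z => ?_
  by_cases hz : D.coeff z = σ
  · simp only [hz, hx0 z hz, Int.cast_zero, ne_eq, not_true_eq_false, false_imp_iff, iff_true]
    exact mem_dualCone.1 hx
  · rw [hQ, forall_mem_convexHull_add_le_iff (mem_dualCone.1 hx), ← hQ, forall_prop_of_true hz]

/-- Gordan's lemma: the monoid is cut out of a lattice by finitely many linear inequalities. -/
theorem fg_sectionMonoid [Module.Free ℤ N] [Module.Finite ℤ N] (hσ : σ.FG)
    (D : PolyhedralDivisor A₀ σ) : D.sectionMonoid.FG := by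
  obtain ⟨T, hT⟩ := hσ
  choose Q hQ _ hQσ using D.isSigmaPolyhedron
  let Z := {z : HeightOneSpectrum A₀ // D.coeff z ≠ σ}
  have : Finite Z := D.finite_support
  have (z : HeightOneSpectrum A₀) : Finite (Q z) := hQ z
  have : AddGroup.FG (DualLattice N × (Z →₀ ℤ)) := Module.Finite.iff_addGroup_fg.1 inferInstance
  let φ : DualLattice N × (Z →₀ ℤ) →+ DualLattice N × (HeightOneSpectrum A₀ →₀ ℤ) :=
    AddMonoidHom.prodMap (.id _) (Finsupp.mapDomain.addMonoidHom Subtype.val)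
  have apply_coe (x) (z : Z) : (φ x).2 z = x.2 z :=
    Finsupp.mapDomain_apply Subtype.val_injective _ _
  have apply_of_eq (x) (z) (hz : D.coeff z = σ) : (φ x).2 z = 0 :=
    Finsupp.mapDomain_of_notMem_range _ _ (by rintro ⟨w, rfl⟩; exact w.2 hz)
  have le_mrange : D.sectionMonoid ≤ AddMonoidHom.mrange φ := by
    rintro ⟨m, E⟩ hx
    refine ⟨(m, E.comapDomain Subtype.val Subtype.val_injective.injOn), Prod.ext rfl
      (Finsupp.mapDomain_comapDomain _ Subtype.val_injective _ fun z hz => ?_)⟩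
    exact ⟨⟨z, fun h => Finsupp.mem_support_iff.1 hz ((hx.2 z).1 h)⟩, rfl⟩
  rw [← AddSubmonoid.map_comap_eq_self le_mrange]
  refine AddSubmonoid.FG.map (fg_of_forall_mem_iff_le_toDualRat (ι := T ⊕ Σ z : Z, Q z)
    (AddMonoidHom.fst _ _)
    (Sum.elim (fun _ => 0) fun p => (Finsupp.applyAddHom p.1).comp (AddMonoidHom.snd _ _))
    (Sum.elim (fun s => s) fun p => p.2) fun x => ?_) φ
  rw [AddSubmonoid.mem_comap, D.mem_sectionMonoid_iff_of_generators hT hQσ,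
    and_iff_right (apply_of_eq x), Sum.forall, Sigma.forall]
  simp only [Sum.elim_inl, Sum.elim_inr, AddMonoidHom.zero_apply, Int.cast_zero, Subtype.forall]
  refine and_congr Iff.rfl (Subtype.forall'.trans (forall_congr' fun z => ?_))
  rw [apply_coe x z]
  rfl

variable [IsDedekindDomain A₀] {K : Type*} [Field K] [Algebra A₀ K] [IsFractionRing A₀ K]

theorem single_mem_sectionAlgebra {D : PolyhedralDivisor A₀ σ} {m : DualLattice N} {f : K} :
    single m f ∈ D.sectionAlgebra K ↔ f ∈ D.piece K (toDualRat m) := by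
  classical
  refine ⟨fun h => by simpa using h m, fun h k => ?_⟩
  rw [coeff_single, Finsupp.single_apply]
  split_ifs with hk
  · exact hk ▸ h
  · exact Submodule.zero_mem _

theorem single_mem_sectionAlgebra_iff_mem_globalSections {D : PolyhedralDivisor A₀ σ}
    {m : DualLattice N} (hm : toDualRat m ∈ dualCone σ) {f : K} :
    single m f ∈ D.sectionAlgebra K ↔ f ∈ globalSections K (D.floorEval hm) := by
  rw [single_mem_sectionAlgebra, piece, dif_pos hm]

theorem single_mem_sectionAlgebra_iff_of_ne_zero {D : PolyhedralDivisor A₀ σ}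
    {m : DualLattice N} {f : K} (hf : f ≠ 0) : single m f ∈ D.sectionAlgebra K ↔
      toDualRat m ∈ dualCone σ ∧ ∀ z, ∀ v ∈ D.coeff z, 0 ≤ ordAt z f + toDualRat m v := by
  rw [single_mem_sectionAlgebra]
  by_cases hm : toDualRat m ∈ dualCone σ
  · simp only [mem_piece K hm, nonneg_add_floor_supportValue_iff, hm, hf, ne_eq, not_false_eq_true,
      forall_const, true_and]
  · simp only [mem_piece_of_not_mem K hm, hf, hm, false_and]

theorem isGradedSubalgebra_sectionAlgebra (D : PolyhedralDivisor A₀ σ) :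
    IsGradedSubalgebra (D.sectionAlgebra K) :=
  fun _ ha m => single_mem_sectionAlgebra.2 (ha m)

theorem single_mem_sectionAlgebra_of_forall_pow (D : PolyhedralDivisor A₀ σ)
    (l m : DualLattice N) (g f : K) (hg : g ≠ 0)
    (h : ∀ n : ℕ, single (l + n • m) (g * f ^ n) ∈ D.sectionAlgebra K) :
    single m f ∈ D.sectionAlgebra K := by
  by_cases hf : f = 0
  · rw [hf, single_zero]
    exact Subalgebra.zero_mem _
  replace h n := (single_mem_sectionAlgebra_iff_of_ne_zero
    (mul_ne_zero hg (pow_ne_zero n hf))).1 (h n)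
  have heval (n : ℕ) (v : RatSpace N) :
      toDualRat (l + n • m) v = toDualRat l v + n • toDualRat m v := by
    rw [map_add, map_nsmul, LinearMap.add_apply, LinearMap.smul_apply]
  refine (single_mem_sectionAlgebra_iff_of_ne_zero hf).2
    ⟨mem_dualCone.2 fun s hs => ?_, fun z v hv => ?_⟩
  · refine nonneg_of_forall_nonneg_add_nsmul (a := toDualRat l s) fun n => ?_
    rw [← heval]
    exact mem_dualCone.1 (h n).1 s hs
  · refine nonneg_of_forall_nonneg_add_nsmul (a := ordAt z g + toDualRat l v) fun n => ?_
    have hn := (h n).2 z v hv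
    rw [heval, ordAt_mul z hg (pow_ne_zero n hf), ordAt_pow] at hn
    push_cast at hn
    rw [nsmul_eq_mul] at hn ⊢
    linarith

theorem gradedPiece_sectionAlgebra_ne_bot (D : PolyhedralDivisor A₀ σ) {m : DualLattice N}
    (hm : toDualRat m ∈ dualCone σ) : gradedPiece (D.sectionAlgebra K) m ≠ ⊥ := by
  obtain ⟨f, hf, hf0⟩ := exists_mem_globalSections_ne_zero (K := K) (D.floorEval hm)
  exact gradedPiece_ne_bot_iff.2
    ⟨f, hf0, (single_mem_sectionAlgebra_iff_mem_globalSections hm).2 hf⟩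

section FullFractionField

variable [Module.Free ℤ N] [Module.Finite ℤ N]

theorem hasFullFractionField_sectionAlgebra (hσ : IsPointedPolyhedralCone σ)
    (D : PolyhedralDivisor A₀ σ) : HasFullFractionField (D.sectionAlgebra K) := by
  refine hasFullFractionField_of_closure_eq_top _ ((AddSubgroup.eq_top_iff' _).2 fun m => ?_)
  obtain ⟨m', hm', hmm'⟩ := exists_mem_dualCone_add_mem_dualCone hσ m
  rw [← add_sub_cancel_right m m']
  exact AddSubgroup.sub_mem _
    (AddSubgroup.subset_closure (D.gradedPiece_sectionAlgebra_ne_bot hmm'))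
    (AddSubgroup.subset_closure (D.gradedPiece_sectionAlgebra_ne_bot hm'))

theorem isIntegrallyClosed_sectionAlgebra (hσ : IsPointedPolyhedralCone σ)
    (D : PolyhedralDivisor A₀ σ) : IsIntegrallyClosed (D.sectionAlgebra K) :=
  isIntegrallyClosed_of_homogeneous D.isGradedSubalgebra_sectionAlgebra
    (D.hasFullFractionField_sectionAlgebra hσ) D.single_mem_sectionAlgebra_of_forall_pow

end FullFractionField

section Uniqueness

theorem supportValue_le_of_sectionAlgebra_le {D D' : PolyhedralDivisor A₀ σ}
    (h : D'.sectionAlgebra K ≤ D.sectionAlgebra K) (z : HeightOneSpectrum A₀)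
    {m : DualLattice N} (hm : toDualRat m ∈ dualCone σ) :
    D'.supportValue z hm ≤ D.supportValue z hm := by
  -- Rounding down loses nothing at a multiple of `m` which clears the denominator.
  let n := (D'.supportValue z hm).den
  have hn : (0 : ℚ) < n := by exact_mod_cast (D'.supportValue z hm).den_pos
  have hnm : toDualRat (n • m) = n • toDualRat m := map_nsmul _ _ _
  have hnσ : toDualRat (n • m) ∈ dualCone σ := hnm ▸ (dualCone σ).nsmul_mem hm n
  have hle : globalSections K (D'.floorEval hnσ) ≤ globalSections K (D.floorEval hnσ) :=
    fun f hf => (single_mem_sectionAlgebra_iff_mem_globalSections hnσ).1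
      (h ((single_mem_sectionAlgebra_iff_mem_globalSections hnσ).2 hf))
  have hfloor := le_of_globalSections_le hle z
  rw [floorEval_apply, floorEval_apply, D'.supportValue_of_eq_nsmul z hnm hm hnσ,
    D.supportValue_of_eq_nsmul z hnm hm hnσ, Rat.den_mul_eq_num, Int.floor_intCast,
    Int.le_floor, ← Rat.den_mul_eq_num] at hfloor
  exact le_of_mul_le_mul_left hfloor hn

variable [Module.Free ℤ N] [Module.Finite ℤ N]

theorem coeff_subset_of_sectionAlgebra_le (hσ : σ.FG) {D D' : PolyhedralDivisor A₀ σ}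
    (h : D'.sectionAlgebra K ≤ D.sectionAlgebra K) (z : HeightOneSpectrum A₀) :
    D.coeff z ⊆ D'.coeff z := by
  intro v hv
  by_contra hv'
  obtain ⟨m, hm, hlt⟩ := exists_supportValue_lt_of_notMem hσ hv hv'
  exact hlt.not_ge (supportValue_le_of_sectionAlgebra_le h z hm)

theorem eq_of_sectionAlgebra_eq (hσ : σ.FG) {D D' : PolyhedralDivisor A₀ σ}
    (h : D.sectionAlgebra K = D'.sectionAlgebra K) : D = D' :=
  PolyhedralDivisor.ext (funext fun z =>
    Set.Subset.antisymm (coeff_subset_of_sectionAlgebra_le hσ h.ge z)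
      (coeff_subset_of_sectionAlgebra_le hσ h.le z))

end Uniqueness

section Noetherian

theorem sectionAlgebra_eq_adjoin (D : PolyhedralDivisor A₀ σ) :
    D.sectionAlgebra K = Algebra.adjoin A₀
      (⋃ x ∈ D.sectionMonoid, single x.1 '' (globalSections K x.2 : Set K)) := by
  refine le_antisymm (fun a ha => mem_of_forall_single_mem fun m => ?_)
    (Algebra.adjoin_le (Set.iUnion₂_subset fun x hx => ?_))
  · by_cases hm : toDualRat m ∈ dualCone σ
    · have ham := ha m
      rw [piece, dif_pos hm] at ham
      exact Algebra.subset_adjoin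
        (Set.mem_iUnion₂_of_mem (D.mk_floorEval_mem_sectionMonoid hm) ⟨_, ham, rfl⟩)
    · rw [(mem_piece_of_not_mem K hm).1 (ha m), single_zero]
      exact Subalgebra.zero_mem _
  · rintro _ ⟨f, hf, rfl⟩
    refine (single_mem_sectionAlgebra_iff_mem_globalSections hx.1).2 fun hf0 z => ?_
    refine (hf hf0 z).trans (add_le_add_right ?_ _)
    rw [floorEval_apply, Int.le_floor]
    exact (D.le_supportValue_iff z hx.1).2 (hx.2 z).2

theorem isNoetherianRing_sectionAlgebra [Module.Free ℤ N] [Module.Finite ℤ N] (hσ : σ.FG)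
    (D : PolyhedralDivisor A₀ σ) : IsNoetherianRing (D.sectionAlgebra K) := by
  rw [sectionAlgebra_eq_adjoin]
  exact isNoetherianRing_of_fg (fg_adjoin_iUnion_single_globalSections (D.fg_sectionMonoid hσ))

end Noetherian

end PolyhedralDivisor

/-! ### Homogeneous generators -/

section NormalizationIn

variable {A₀ : Type*} [CommRing A₀] {K : Type*} [Field K] [Algebra A₀ K]
  {N : Type*} [AddCommGroup N]

theorem imageInFractionField_injective :
    Function.Injective (imageInFractionField (A₀ := A₀) (K := K) (N := N)) :=
  Subalgebra.map_injective (IsFractionRing.injective (AddMonoidAlgebra K (DualLattice N)) _)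

theorem normalizationIn_eq_imageInFractionField
    {A B : Subalgebra A₀ (AddMonoidAlgebra K (DualLattice N))} (hAB : A ≤ B)
    [IsIntegrallyClosed B] (hB : HasFullFractionField B) (hint : ∀ b ∈ B, IsIntegral A b) :
    normalizationIn A = imageInFractionField B := by
  let L := FractionRing (AddMonoidAlgebra K (DualLattice N))
  have : IsFractionRing B L := hB
  ext x
  constructor
  · intro (hx : IsIntegral A x)
    have hxB : IsIntegral B x :=
      hx.map_of_comp_eq (Subalgebra.inclusion hAB).toRingHom (RingHom.id L) rfl
    obtain ⟨y, rfl⟩ := (isIntegrallyClosed_iff L).1 ‹_› hxB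
    exact ⟨y, y.2, rfl⟩
  · rintro ⟨y, hy, rfl⟩
    exact (hint y hy).algebraMap (B := L)

end NormalizationIn

section Adjoin

open AddMonoidAlgebra

theorem single_sum_prod_mem_adjoin {A₀ R G ι : Type*} [CommSemiring A₀] [CommSemiring R]
    [Algebra A₀ R] [AddCommMonoid G] [Fintype ι] (m : ι → G) (f : ι → R) (a : ι → ℕ) :
    single (∑ i, a i • m i) (∏ i, f i ^ a i) ∈
      Algebra.adjoin A₀ (Set.range fun i => single (m i) (f i)) := by
  simp only [← prod_single, ← single_pow]
  exact Subalgebra.prod_mem _ fun i _ =>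
    Subalgebra.pow_mem _ (Algebra.subset_adjoin (Set.mem_range_self i)) _

theorem mem_of_mem_adjoin_of_coeff_ne_zero {A₀ R G ι : Type*} [CommSemiring A₀] [CommSemiring R]
    [Algebra A₀ R] [AddCommMonoid G] {m : ι → G} {f : ι → R} {H : AddSubmonoid G}
    (hH : ∀ i, m i ∈ H) {a : AddMonoidAlgebra R G}
    (ha : a ∈ Algebra.adjoin A₀ (Set.range fun i => single (m i) (f i))) {k : G}
    (hk : a.coeff k ≠ 0) : k ∈ H := by
  classical
  induction ha using Algebra.adjoin_induction generalizing k with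
  | mem x hx =>
    obtain ⟨i, rfl⟩ := hx
    rw [coeff_single, Finsupp.single_apply_ne_zero] at hk
    exact hk.1 ▸ hH i
  | algebraMap c =>
    rw [coe_algebraMap, Function.comp_apply, coeff_single, Finsupp.single_apply_ne_zero] at hk
    exact hk.1 ▸ H.zero_mem
  | add x y _ _ hx hy =>
    by_cases h : x.coeff k = 0
    · rw [coeff_add, Finsupp.add_apply, h, zero_add] at hk
      exact hy hk
    · exact hx h
  | mul x y _ _ hx hy =>
    obtain ⟨p, hp, q, hq, rfl⟩ :=
      Finset.mem_add.1 (support_coeff_mul_subset x y (Finsupp.mem_support_iff.2 hk))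
    exact H.add_mem (hx (Finsupp.mem_support_iff.1 hp)) (hy (Finsupp.mem_support_iff.1 hq))

variable {A₀ : Type*} [CommRing A₀] {K : Type*} [Field K] [Algebra A₀ K]
  {N : Type*} [AddCommGroup N] {ι : Type*} {m : ι → DualLattice N} {f : ι → K}

theorem gradedPiece_adjoin_ne_bot (hf : ∀ i, f i ≠ 0) (i : ι) :
    gradedPiece (Algebra.adjoin A₀ (Set.range fun i => single (m i) (f i))) (m i) ≠ ⊥ :=
  gradedPiece_ne_bot_iff.2 ⟨f i, hf i, Algebra.subset_adjoin ⟨i, rfl⟩⟩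

theorem weightCone_adjoin (hf : ∀ i, f i ≠ 0) :
    weightCone (Algebra.adjoin A₀ (Set.range fun i => single (m i) (f i))) =
      PointedCone.hull ℚ (Set.range fun i => toDualRat (m i)) := by
  refine le_antisymm (Submodule.span_le.2 ?_) (Submodule.span_mono ?_)
  · rintro _ ⟨k, hk, rfl⟩
    obtain ⟨g, hg0, hg⟩ := gradedPiece_ne_bot_iff.1 hk
    exact mem_of_mem_adjoin_of_coeff_ne_zero
      (H := (PointedCone.hull ℚ (Set.range fun i => toDualRat (m i))).toAddSubmonoid.comap
        (toDualRat (N := N)).toAddMonoidHom)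
      (fun i => PointedCone.subset_hull ⟨i, rfl⟩) hg (by simpa using hg0)
  · rintro _ ⟨i, rfl⟩
    exact ⟨m i, gradedPiece_adjoin_ne_bot hf i, rfl⟩

theorem span_eq_top_of_hasFullFractionField
    (h : HasFullFractionField (Algebra.adjoin A₀ (Set.range fun i => single (m i) (f i)))) :
    Submodule.span ℤ (Set.range m) = ⊤ := by
  refine Submodule.eq_top_iff'.2 fun k =>
    mem_of_hasFullFractionField h (Submodule.span ℤ (Set.range m)).toAddSubgroup
      (fun a ha k hk => ?_) k
  exact mem_of_mem_adjoin_of_coeff_ne_zero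
    (H := (Submodule.span ℤ (Set.range m)).toAddSubmonoid)
    (fun i => Submodule.subset_span ⟨i, rfl⟩) ha hk

theorem hasFullFractionField_adjoin [IsDomain A₀] [IsFractionRing A₀ K] [Module.Free ℤ N]
    [Module.Finite ℤ N] (hf : ∀ i, f i ≠ 0) (hm : Submodule.span ℤ (Set.range m) = ⊤) :
    HasFullFractionField (Algebra.adjoin A₀ (Set.range fun i => single (m i) (f i))) := by
  refine hasFullFractionField_of_closure_eq_top _ (top_le_iff.1 ?_)
  rw [← Submodule.top_toAddSubgroup (R := ℤ), ← hm, Submodule.span_int_eq_addSubgroupClosure]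
  exact AddSubgroup.closure_mono (Set.range_subset_iff.2 (gradedPiece_adjoin_ne_bot hf))

/-- Clearing the denominators of a nonnegative rational relation `∑ l i • m i = k` turns it into
a monomial in the generators. -/
theorem exists_single_nsmul_mem_adjoin_ordAt_eq [IsDedekindDomain A₀] [IsFractionRing A₀ K]
    [Fintype ι] (hf : ∀ i, f i ≠ 0) {O : Type*} [Finite O] {l : O → ι → ℚ}
    (hl : ∀ o i, 0 ≤ l o i) {k : DualLattice N}
    (hk : ∀ o, ∑ i, l o i • toDualRat (m i) = toDualRat k) :
    ∃ n : ℕ, 0 < n ∧ ∃ F : O → K, ∀ o, F o ≠ 0 ∧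
      single (n • k) (F o) ∈ Algebra.adjoin A₀ (Set.range fun i => single (m i) (f i)) ∧
      ∀ z : IsDedekindDomain.HeightOneSpectrum A₀,
        (ordAt z (F o) : ℚ) = n * ∑ i, l o i * ordAt z (f i) := by
  obtain ⟨n, hn, a, ha⟩ :=
    exists_pos_forall_mul_eq_natCast (c := fun p : O × ι => l p.1 p.2) fun p => hl p.1 p.2
  refine ⟨n, hn, fun o => ∏ i, f i ^ a (o, i), fun o =>
    ⟨Finset.prod_ne_zero_iff.2 fun i _ => pow_ne_zero _ (hf i), ?_, fun z => ?_⟩⟩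
  · have hnk : n • k = ∑ i, a (o, i) • m i := by
      apply toDualRat_injective
      simp only [map_sum, map_nsmul, ← hk o, Finset.smul_sum, ← Nat.cast_smul_eq_nsmul ℚ, ha,
        mul_smul]
    rw [hnk]
    exact single_sum_prod_mem_adjoin _ _ _
  · rw [ordAt_prod_pow z _ _ _ fun i _ => hf i, Finset.mul_sum]
    push_cast
    simp only [ha, mul_assoc]

end Adjoin

section Generators

open AddMonoidAlgebra IsDedekindDomain

variable {N : Type*} [AddCommGroup N] {r : ℕ} {m : Fin r → DualLattice N}

theorem dualOfWeights_eq_dual_range :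
    dualOfWeights m = PointedCone.dual .id (Set.range fun i => toDualRat (m i)) :=
  PointedCone.dual_hull _

theorem mem_dualOfWeights {v : RatSpace N} :
    v ∈ dualOfWeights m ↔ ∀ i, 0 ≤ toDualRat (m i) v := by
  rw [dualOfWeights_eq_dual_range, PointedCone.mem_dual, Set.forall_mem_range]
  rfl

theorem dualCone_dualOfWeights [Module.Finite ℤ N] :
    dualCone (dualOfWeights m) = PointedCone.hull ℚ (Set.range fun i => toDualRat (m i)) :=
  dual_eval_dual_id_of_fg (Submodule.fg_span (Set.finite_range _))

theorem eq_zero_of_forall_toDualRat_eq_zero [Module.Free ℤ N] [Module.Finite ℤ N] {ι : Type*}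
    {m : ι → DualLattice N} (hm : Submodule.span ℤ (Set.range m) = ⊤) {v : RatSpace N}
    (hv : ∀ i, toDualRat (m i) v = 0) : v = 0 := by
  let evalAt : DualLattice N →ₗ[ℤ] ℚ :=
    (Module.Dual.eval ℚ (RatSpace N) v).restrictScalars ℤ ∘ₗ toDualRat
  have hker : ⊤ ≤ LinearMap.ker evalAt := hm ▸ Submodule.span_le.2 (Set.range_subset_iff.2 hv)
  refine (Module.forall_dual_apply_eq_zero_iff ℚ v).1 fun u => ?_
  obtain ⟨k, hk, m', hm'⟩ := exists_pos_smul_eq_toDualRat u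
  have hku : (k : ℚ) * u v = 0 := by
    rw [← smul_eq_mul, ← LinearMap.smul_apply, hm']
    exact hker (Submodule.mem_top (x := m'))
  exact (mul_eq_zero.1 hku).resolve_left (Nat.cast_ne_zero.2 hk.ne')

theorem isPointedPolyhedralCone_dualOfWeights [Module.Free ℤ N] [Module.Finite ℤ N]
    (hm : Submodule.span ℤ (Set.range m) = ⊤) : IsPointedPolyhedralCone (dualOfWeights m) := by
  refine ⟨fg_of_dualFG_id ?_, fun v hv hv0 hv' => hv0 ?_⟩
  · rw [dualOfWeights_eq_dual_range]
    exact PointedCone.DualFG.dual_of_finite _ (Set.finite_range _)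
  · exact eq_zero_of_forall_toDualRat_eq_zero hm fun i => le_antisymm
      (by simpa using mem_dualOfWeights.1 hv' i) (mem_dualOfWeights.1 hv i)

variable {A₀ : Type*} [CommRing A₀] [IsDedekindDomain A₀]
  {K : Type*} [Field K] [Algebra A₀ K] [IsFractionRing A₀ K] {f : Fin r → K}

theorem adjoin_le_sectionAlgebra (hf : ∀ i, f i ≠ 0) {D : PolyhedralDivisor A₀ (dualOfWeights m)}
    (hD : ∀ z, D.coeff z = generatorPolyhedron f m z) :
    Algebra.adjoin A₀ (Set.range fun i => single (m i) (f i)) ≤ D.sectionAlgebra K := by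
  refine Algebra.adjoin_le (Set.range_subset_iff.2 fun i => ?_)
  refine (PolyhedralDivisor.single_mem_sectionAlgebra_iff_of_ne_zero (hf i)).2
    ⟨mem_dualCone.2 fun v hv => mem_dualOfWeights.1 hv i, fun z v hv => ?_⟩
  rw [hD] at hv
  exact neg_le_iff_add_nonneg'.1 (hv i)

theorem generatorPolyhedron_eq_dualOfWeights {z : HeightOneSpectrum A₀}
    (hz : ∀ i, ordAt z (f i) = 0) : generatorPolyhedron f m z = dualOfWeights m := by
  ext v
  simp only [generatorPolyhedron, hz, Int.cast_zero, neg_zero, Set.mem_ofPred_eq, SetLike.mem_coe,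
    mem_dualOfWeights]

variable [Module.Finite ℤ N]

theorem exists_polyhedralDivisor_coeff_eq (hf : ∀ i, f i ≠ 0)
    (hne : ∀ z : HeightOneSpectrum A₀, (generatorPolyhedron f m z).Nonempty) :
    ∃ D : PolyhedralDivisor A₀ (dualOfWeights m), ∀ z, D.coeff z = generatorPolyhedron f m z := by
  refine ⟨⟨fun z => generatorPolyhedron f m z, fun z => ?_, ?_⟩, fun z => rfl⟩
  · rw [dualOfWeights_eq_dual_range]
    exact exists_finite_convexHull_add_dual_eq _ _ (hne z)
  · refine (Set.finite_iUnion fun i => finite_ordAt_ne_zero (A₀ := A₀) (hf i)).subset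
      fun z hz => ?_
    by_contra! h
    simp only [Set.mem_iUnion, Set.mem_ofPred_eq, not_exists, not_not] at h
    exact hz (generatorPolyhedron_eq_dualOfWeights h)

/-- A certificate of emptiness of `Δ_z[f]` is an element of degree zero with a pole at `z`. -/
theorem generatorPolyhedron_nonempty (hf : ∀ i, f i ≠ 0)
    (h0 : gradedPiece (Algebra.adjoin A₀ (Set.range fun i => single (m i) (f i))) 0 = 1)
    (z : HeightOneSpectrum A₀) : (generatorPolyhedron f m z).Nonempty := by
  by_contra hne
  obtain ⟨l, hl, hl0, hlpos⟩ := exists_nonneg_sum_smul_eq_zero_of_infeasible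
    (fun i => toDualRat (m i)) (fun i => -(ordAt z (f i) : ℚ)) hne
  obtain ⟨n, hn, F, hF⟩ := exists_single_nsmul_mem_adjoin_ordAt_eq (A₀ := A₀) hf
    (O := Unit) (l := fun _ => l) (fun _ => hl) (k := 0) fun _ => hl0.trans (map_zero _).symm
  obtain ⟨hF0, hFA, hFord⟩ := hF ()
  rw [smul_zero, ← mem_gradedPiece, h0, Submodule.mem_one] at hFA
  obtain ⟨c, hc⟩ := hFA
  have hc0 : c ≠ 0 := by
    rintro rfl
    exact hF0 (by rw [← hc, map_zero])
  have hord := ordAt_algebraMap_nonneg (K := K) z hc0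
  rw [show algebraMap A₀ K c = F () from hc, ← Int.cast_nonneg_iff (R := ℚ), hFord] at hord
  simp only [mul_neg, Finset.sum_neg_distrib, neg_pos] at hlpos
  exact hord.not_gt (mul_neg_of_pos_of_neg (by exact_mod_cast hn) hlpos)

theorem exists_nonneg_sum_smul_eq_of_forall_mem_generatorPolyhedron {z : HeightOneSpectrum A₀}
    (hne : (generatorPolyhedron f m z).Nonempty) {k : DualLattice N} {b : K}
    (h : ∀ v ∈ generatorPolyhedron f m z, 0 ≤ ordAt z b + toDualRat k v) :
    ∃ l : Fin r → ℚ, (∀ i, 0 ≤ l i) ∧ ∑ i, l i • toDualRat (m i) = toDualRat k ∧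
      ∑ i, l i * ordAt z (f i) ≤ ordAt z b := by
  obtain ⟨l, hl, hlk, hle⟩ := exists_nonneg_sum_smul_eq_of_forall_le
    (fun i => toDualRat (m i)) (fun i => -(ordAt z (f i) : ℚ)) hne (toDualRat k)
    (-(ordAt z b : ℚ)) fun v hv => neg_le_iff_add_nonneg'.2 (h v hv)
  refine ⟨l, hl, hlk, ?_⟩
  simpa only [mul_neg, Finset.sum_neg_distrib, neg_le_neg_iff] using hle

/-- Linear programming duality on `Δ_z[f]` yields, at each of the finitely many `z` where some
`f i` is not a unit, a monomial in the generators whose order at `z` is at most that of a power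
of `b`. These monomials span a module which locally, hence globally, contains that power. -/
theorem exists_single_pow_mem_adjoin (hf : ∀ i, f i ≠ 0)
    {D : PolyhedralDivisor A₀ (dualOfWeights m)}
    (hD : ∀ z, D.coeff z = generatorPolyhedron f m z) {k : DualLattice N} {b : K} (hb0 : b ≠ 0)
    (hb : single k b ∈ D.sectionAlgebra K) : ∃ n : ℕ, 0 < n ∧
      single k b ^ n ∈ Algebra.adjoin A₀ (Set.range fun i => single (m i) (f i)) := by
  obtain ⟨hk, hbz⟩ := (PolyhedralDivisor.single_mem_sectionAlgebra_iff_of_ne_zero hb0).1 hb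
  simp only [hD] at hbz
  have hne (z) : (generatorPolyhedron f m z).Nonempty :=
    hD z ▸ (D.isLeast_supportValue z hk).nonempty.of_image
  let Z : Set (HeightOneSpectrum A₀) := ⋃ i, {z | ordAt z (f i) ≠ 0}
  have : Finite Z := Set.finite_iUnion fun i => finite_ordAt_ne_zero (A₀ := A₀) (hf i)
  obtain ⟨l₀, hl₀, hl₀k⟩ := exists_nonneg_sum_smul_eq (fun i => toDualRat (m i)) (toDualRat k)
    fun v hv => mem_dualCone.1 hk v (mem_dualOfWeights.2 hv)
  choose l hl hlk hlb using fun z =>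
    exists_nonneg_sum_smul_eq_of_forall_mem_generatorPolyhedron (hne z) (hbz z)
  let L (o : Option Z) : Fin r → ℚ := o.elim l₀ fun z => l z
  have hLb (z : HeightOneSpectrum A₀) : ∃ o, ∑ i, L o i * ordAt z (f i) ≤ ordAt z b := by
    by_cases hz : z ∈ Z
    · exact ⟨some ⟨z, hz⟩, hlb z⟩
    · have hz0 : ∀ i, ordAt z (f i) = 0 := by simpa [Z] using hz
      exact ⟨none, by simpa only [hz0, Int.cast_zero, mul_zero, Finset.sum_const_zero] using hlb z⟩
  obtain ⟨n, hn, F, hF⟩ := exists_single_nsmul_mem_adjoin_ordAt_eq (A₀ := A₀) hf (l := L)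
    (Option.forall.2 ⟨hl₀, fun z => hl z⟩) (Option.forall.2 ⟨hl₀k, fun z => hlk z⟩)
  choose hF0 hFA hFord using hF
  refine ⟨n, hn, ?_⟩
  rw [single_pow, ← mem_gradedPiece]
  refine Submodule.span_le.2 (Set.range_subset_iff.2 hFA) (mem_span_of_forall_exists_ordAt_le
    ⟨F none, Set.mem_range_self none, hF0 none⟩ (pow_ne_zero n hb0) fun z => ?_)
  obtain ⟨o, ho⟩ := hLb z
  refine ⟨F o, Set.mem_range_self o, hF0 o, ?_⟩
  rw [ordAt_pow, ← Int.cast_le (R := ℚ), hFord, Int.cast_mul, Int.cast_natCast]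
  exact mul_le_mul_of_nonneg_left ho n.cast_nonneg

theorem isIntegral_of_mem_sectionAlgebra (hf : ∀ i, f i ≠ 0)
    {D : PolyhedralDivisor A₀ (dualOfWeights m)}
    (hD : ∀ z, D.coeff z = generatorPolyhedron f m z) {a : AddMonoidAlgebra K (DualLattice N)}
    (ha : a ∈ D.sectionAlgebra K) :
    IsIntegral (Algebra.adjoin A₀ (Set.range fun i => single (m i) (f i))) a := by
  rw [← sum_coeff_single a]
  refine IsIntegral.sum _ fun k hk => ?_
  obtain ⟨n, hn, hmem⟩ := exists_single_pow_mem_adjoin hf hD (Finsupp.mem_support_iff.1 hk)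
    (D.isGradedSubalgebra_sectionAlgebra a ha k)
  exact .of_pow hn (isIntegral_algebraMap
    (x := (⟨_, hmem⟩ : Algebra.adjoin A₀ (Set.range fun i => single (m i) (f i)))))

theorem normalizationIn_adjoin_eq [Module.Free ℤ N] (hf : ∀ i, f i ≠ 0)
    (hm : Submodule.span ℤ (Set.range m) = ⊤) {D : PolyhedralDivisor A₀ (dualOfWeights m)}
    (hD : ∀ z, D.coeff z = generatorPolyhedron f m z) :
    normalizationIn (Algebra.adjoin A₀ (Set.range fun i => single (m i) (f i))) =
      imageInFractionField (D.sectionAlgebra K) := by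
  have hσ := isPointedPolyhedralCone_dualOfWeights hm
  have := D.isIntegrallyClosed_sectionAlgebra (K := K) hσ
  exact normalizationIn_eq_imageInFractionField (adjoin_le_sectionAlgebra hf hD)
    (D.hasFullFractionField_sectionAlgebra hσ) fun _ => isIntegral_of_mem_sectionAlgebra hf hD

theorem exists_eq_sectionAlgebra [Module.Free ℤ N] {σ : PointedCone ℚ (RatSpace N)} (hσ : σ.FG)
    {A : Subalgebra A₀ (AddMonoidAlgebra K (DualLattice N))} (hA : IsGradedSubalgebra A)
    (h0 : gradedPiece A 0 = 1) (hw : weightCone A = dualCone σ) [IsIntegrallyClosed A]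
    [IsNoetherianRing A] (hfull : HasFullFractionField A) :
    ∃ D : PolyhedralDivisor A₀ σ, A = D.sectionAlgebra K := by
  obtain ⟨r, f, m, hf, rfl⟩ := exists_adjoin_eq_of_isNoetherianRing hA h0
  have hm := span_eq_top_of_hasFullFractionField hfull
  obtain rfl : σ = dualOfWeights m := by
    rw [dualOfWeights, ← weightCone_adjoin (A₀ := A₀) hf, hw]
    exact (dual_id_dual_eval_of_fg hσ).symm
  obtain ⟨D, hD⟩ := exists_polyhedralDivisor_coeff_eq hf (generatorPolyhedron_nonempty hf h0)
  refine ⟨D, imageInFractionField_injective ?_⟩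
  rw [← normalizationIn_adjoin_eq hf hm hD]
  exact (normalizationIn_eq_imageInFractionField le_rfl hfull fun b hb =>
    isIntegral_algebraMap
      (x := (⟨b, hb⟩ : Algebra.adjoin A₀ (Set.range fun i => single (m i) (f i))))).symm

end Generators

theorem mainTheorem2 {A₀ : Type*} [CommRing A₀] [IsDedekindDomain A₀]
    {K₀ : Type*} [Field K₀] [Algebra A₀ K₀] [IsFractionRing A₀ K₀]
    {N : Type*} [AddCommGroup N] [Module.Free ℤ N] [Module.Finite ℤ N] :
    (∀ σ : PointedCone ℚ (RatSpace N), IsPointedPolyhedralCone σ →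
      (∀ D : PolyhedralDivisor A₀ σ,
        IsIntegrallyClosed (D.sectionAlgebra K₀) ∧
        IsNoetherianRing (D.sectionAlgebra K₀) ∧
        HasFullFractionField (D.sectionAlgebra K₀)) ∧
      (∀ A : Subalgebra A₀ (AddMonoidAlgebra K₀ (DualLattice N)),
        IsGradedSubalgebra A → gradedPiece A 0 = 1 → weightCone A = dualCone σ →
        IsIntegrallyClosed A → IsNoetherianRing A → HasFullFractionField A →
        ∃! D : PolyhedralDivisor A₀ σ, A = D.sectionAlgebra K₀)) ∧
    (∀ (r : ℕ) (f : Fin r → K₀) (m : Fin r → DualLattice N),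
      (∀ i, f i ≠ 0) → (∀ i, m i ≠ 0) → Submodule.span ℤ (Set.range m) = ⊤ →
      IsPointedPolyhedralCone (dualOfWeights m) ∧
      dualCone (dualOfWeights m) = PointedCone.hull ℚ (Set.range fun i => toDualRat (m i)) ∧
      HasFullFractionField
        (Algebra.adjoin A₀ (Set.range fun i => AddMonoidAlgebra.single (m i) (f i))) ∧
      ((∀ z : IsDedekindDomain.HeightOneSpectrum A₀, (generatorPolyhedron f m z).Nonempty) →
        ∃ D : PolyhedralDivisor A₀ (dualOfWeights m),
          (∀ z, D.coeff z = generatorPolyhedron f m z) ∧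
          normalizationIn
              (Algebra.adjoin A₀ (Set.range fun i => AddMonoidAlgebra.single (m i) (f i))) =
            imageInFractionField (D.sectionAlgebra K₀))) := by
  refine ⟨fun σ hσ => ⟨fun D => ⟨D.isIntegrallyClosed_sectionAlgebra hσ,
    D.isNoetherianRing_sectionAlgebra hσ.1, D.hasFullFractionField_sectionAlgebra hσ⟩, ?_⟩, ?_⟩
  · intro A hA h0 hw hic hnoeth hfull
    obtain ⟨D, hD⟩ := exists_eq_sectionAlgebra hσ.1 hA h0 hw hfull
    exact ⟨D, hD, fun D' hD' =>
      PolyhedralDivisor.eq_of_sectionAlgebra_eq hσ.1 (hD'.symm.trans hD)⟩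
  · intro r f m hf _ hm
    refine ⟨isPointedPolyhedralCone_dualOfWeights hm, dualCone_dualOfWeights,
      hasFullFractionField_adjoin hf hm, fun hne => ?_⟩
    obtain ⟨D, hD⟩ := exists_polyhedralDivisor_coeff_eq hf hne
    exact ⟨D, hD, normalizationIn_adjoin_eq hf hm hD⟩
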